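/- A polytope in $\mathbb R^n$ is the convex hull of a nonempty finite set of points, and $\mathcal P^n$ denotes the set of all polytopes in $\mathbb R^n$. A function $Z:\mathcal P^n\to\mathbb R^n$ is a valuation if $Z(P)+Z(Q)=Z(P\cup Q)+Z(P\cap Q)$ for all $P,Q\in\mathcal P^n$ with $P\cup Q\in\mathcal P^n$, and it is $\mathrm{SL}(n)$ contravariant if $Z(\phi P)=\phi^{-t}Z(P)$ for all $P\in\mathcal P^n$ and $\phi\in\mathrm{SL}(n)$. A function $\zeta:[0,\infty)\to\mathbb R$ is a solution of Cauchy's functional equation if $\zeta(x+y)=\zeta(x)+\zeta(y)$ for all $x,y\ge 0$. For $P\in\mathcal P^n$ and a unit vector $u$ let $h_P(u)=\max\{\langle x,u\rangle:x\in P\}$ and $F(P,u)=\{x\in P:\langle x,u\rangle=h_P(u)\}$. Let $\mathcal N(P)$ be the (finite) set of unit vectors $u$ for which $F(P,u)$ has dimension $n-1$ (so that both unit normals of $P$ belong to $\mathcal N(P)$ if $\dim P=n-1$), and let $\mathcal N_o(P)$ be the set of those $u\in\mathcal N(P)$ for which the affine hull of $F(P,u)$ contains the origin $o$. Let $V(P,u)$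 be the $n$-dimensional volume of $\mathrm{conv}(\{o\}\cup F(P,u))$. For a solution $\zeta$ of Cauchy's functional equation, the facet vector of $P$ is $$\mathrm{fv}_\zeta(P)=\sum_{u\in\mathcal N(P)\setminus\mathcal N_o(P)}\frac{\zeta(V(P,u))}{|h_P(u)|}\,u .$$ **Theorem 1.3.** Let $n\ge 3$. A function $Z:\mathcal P^n\to\mathbb R^n$ is an $\mathrm{SL}(n)$ contravariant valuation if and only if there exist solutions $\zeta_1,\zeta_2:[0,\infty)\to\mathbb R$ of Cauchy's functional equation such that $$Z(P)=\mathrm{fv}_{\zeta_1}(P)+\mathrm{fv}_{\zeta_2}(\mathrm{conv}(\{o\}\cup P))$$ for every $P\in\mathcal P^n$. -/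

import Mathlib

open scoped NNReal

noncomputable section

/-- The space of all (nonempty) polytopes in `ℝⁿ`: the convex hulls of finitely many points. -/
def PolytopeIn (n : ℕ) : Type :=
  {P : Set (EuclideanSpace ℝ (Fin n)) //
    ∃ s : Set (EuclideanSpace ℝ (Fin n)), s.Finite ∧ s.Nonempty ∧ convexHull ℝ s = P}

namespace PolytopeIn

variable {n : ℕ}

/-- The set of points of a polytope. -/
def carrier (P : PolytopeIn n) : Set (EuclideanSpace ℝ (Fin n)) := P.1

/-- The image `A P` of a polytope under the linear map with matrix `A`. -/
def image (A : Matrix (Fin n) (Fin n) ℝ) (P : PolytopeIn n) : PolytopeIn n :=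
  ⟨Matrix.toEuclideanLin A '' P.carrier, by
    obtain ⟨s, hs, hne, h⟩ := P.2
    refine ⟨Matrix.toEuclideanLin A '' s, hs.image _, hne.image _, ?_⟩
    rw [← LinearMap.image_convexHull, h]
    rfl⟩

/-- The convex hull `[o, P]` of a polytope and the origin. -/
def convOrigin (P : PolytopeIn n) : PolytopeIn n :=
  ⟨convexHull ℝ (insert 0 P.carrier), by
    obtain ⟨s, hs, hne, h⟩ := P.2
    refine ⟨insert 0 s, hs.insert 0, Set.insert_nonempty 0 s, ?_⟩
    change _ = convexHull ℝ (insert 0 P.1)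
    rw [← h]
    refine Set.Subset.antisymm
      (convexHull_mono (Set.insert_subset_insert (subset_convexHull ℝ s)))
      (convexHull_min (Set.insert_subset ?_ ?_) (convex_convexHull ℝ _))
    · exact subset_convexHull ℝ _ (Set.mem_insert 0 s)
    · exact convexHull_mono (Set.subset_insert 0 s)⟩

/-- The support function `h_P(u) = max {⟨x, u⟩ : x ∈ P}`. -/
def supportFun (P : PolytopeIn n) (u : EuclideanSpace ℝ (Fin n)) : ℝ :=
  sSup ((fun x => inner ℝ x u) '' P.carrier)

/-- The face `F(P, u)` of `P` in direction `u`. -/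
def face (P : PolytopeIn n) (u : EuclideanSpace ℝ (Fin n)) : Set (EuclideanSpace ℝ (Fin n)) :=
  {x ∈ P.carrier | inner ℝ x u = P.supportFun u}

/-- The set of outer unit normals of the facets, i.e. the `(n-1)`-dimensional faces, of `P`.
If `P` itself has dimension `n - 1`, then both unit normals of `P` belong to it. -/
def facetNormals (P : PolytopeIn n) : Set (EuclideanSpace ℝ (Fin n)) :=
  {u | ‖u‖ = 1 ∧ Module.finrank ℝ (vectorSpan ℝ (P.face u)) + 1 = n}

/-- The set of outer unit normals of the facets of `P` whose affine hull contains the origin. -/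
def facetNormalsOrigin (P : PolytopeIn n) : Set (EuclideanSpace ℝ (Fin n)) :=
  {u ∈ P.facetNormals | 0 ∈ affineSpan ℝ (P.face u)}

/-- The volume `V(P, u)` of the cone `[o, F(P, u)]`. -/
def coneVolume (P : PolytopeIn n) (u : EuclideanSpace ℝ (Fin n)) : ℝ≥0 :=
  (MeasureTheory.volume (convexHull ℝ (insert 0 (P.face u)))).toNNReal

/-- A polytope has only finitely many facet normals. -/
theorem facetNormals_finite (P : PolytopeIn n) : P.facetNormals.Finite := by
  obtain ⟨s, hs, -, h⟩ := P.2
  have hP : P.carrier = convexHull ℝ s := h.symm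
  have hle : ∀ u, ∀ x ∈ P.carrier, inner ℝ x u ≤ P.supportFun u := by
    intro u x hx
    have hc : IsCompact P.carrier := hP ▸ hs.isCompact_convexHull ℝ
    exact le_csSup (hc.image (by fun_prop)).bddAbove (Set.mem_image_of_mem _ hx)
  have key : ∀ u, P.face u ⊆ convexHull ℝ (s ∩ P.face u) := by
    rintro u x ⟨hx, hxu⟩
    have hx' := hx
    rw [hP, ← hs.coe_toFinset, Finset.mem_convexHull'] at hx'
    obtain ⟨w, hw0, hw1, hwx⟩ := hx'
    have hsum : ∑ v ∈ hs.toFinset, w v * (P.supportFun u - inner ℝ v u) = 0 := by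
      have : ∑ v ∈ hs.toFinset, w v * inner ℝ v u = P.supportFun u := by
        rw [← hxu, ← hwx, sum_inner]
        exact Finset.sum_congr rfl fun v _ => (real_inner_smul_left _ _ _).symm
      simp only [mul_sub, Finset.sum_sub_distrib, ← Finset.sum_mul, hw1, this, one_mul, sub_self]
    have hmem : ∀ v ∈ hs.toFinset, v ∈ P.carrier := fun v hv =>
      hP ▸ subset_convexHull ℝ s (hs.mem_toFinset.1 hv)
    have hz := (Finset.sum_eq_zero_iff_of_nonneg (fun v hv =>
      mul_nonneg (hw0 v hv) (sub_nonneg.2 (hle u v (hmem v hv))))).1 hsum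
    have hface : ∀ v ∈ hs.toFinset, w v ≠ 0 → v ∈ s ∩ P.face u := fun v hv hwv =>
      ⟨hs.mem_toFinset.1 hv, hmem v hv,
        (sub_eq_zero.1 ((mul_eq_zero.1 (hz v hv)).resolve_left hwv)).symm⟩
    classical
    rw [← hwx, ← Finset.sum_filter_of_ne (p := fun v => w v ≠ 0)
      (fun v _ hv => left_ne_zero_of_smul hv)]
    refine (convex_convexHull ℝ _).sum_mem (fun v hv => hw0 v (Finset.mem_filter.1 hv).1) ?_ ?_
    · rw [Finset.sum_filter_of_ne (fun v _ hv => hv), hw1]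
    · intro v hv
      exact subset_convexHull ℝ _ (hface v (Finset.mem_filter.1 hv).1 (Finset.mem_filter.1 hv).2)
  have hspan : ∀ u, vectorSpan ℝ (P.face u) = vectorSpan ℝ (s ∩ P.face u) := by
    intro u
    refine le_antisymm ?_ (vectorSpan_mono ℝ Set.inter_subset_right)
    have := vectorSpan_mono ℝ (key u)
    rwa [← direction_affineSpan ℝ (convexHull ℝ _), affineSpan_convexHull,
      direction_affineSpan] at this
  refine Set.Finite.of_finite_fibers (fun u => s ∩ P.face u)
    (hs.finite_subsets.subset ?_) ?_
  · rintro _ ⟨u, -, rfl⟩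
    exact Set.inter_subset_left
  rintro _ ⟨u₀, ⟨hu₀, hd₀⟩, rfl⟩
  refine (Set.toFinite {u₀, -u₀}).subset ?_
  rintro u ⟨⟨hu, -⟩, hF⟩
  have hF' : s ∩ P.face u = s ∩ P.face u₀ := hF
  have horth : ∀ u, u ∈ (vectorSpan ℝ (P.face u))ᗮ := by
    intro u
    have : vectorSpan ℝ (P.face u) ≤ (ℝ ∙ u)ᗮ := by
      refine Submodule.span_le.2 ?_
      rintro _ ⟨a, ha, b, hb, rfl⟩
      rw [SetLike.mem_coe, Submodule.mem_orthogonal_singleton_iff_inner_left]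
      simp only [vsub_eq_sub]
      rw [inner_sub_left, ha.2, hb.2, sub_self]
    exact Submodule.le_orthogonal_iff_le_orthogonal.1 this (Submodule.mem_span_singleton_self u)
  have hu' := horth u
  rw [hspan u, hF', ← hspan u₀] at hu'
  have h1 : Module.finrank ℝ (vectorSpan ℝ (P.face u₀))ᗮ = 1 := by
    have := Submodule.finrank_add_finrank_orthogonal (vectorSpan ℝ (P.face u₀))
    rw [finrank_euclideanSpace_fin] at this
    omega
  have hne : (⟨u₀, horth u₀⟩ : (vectorSpan ℝ (P.face u₀))ᗮ) ≠ 0 := by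
    intro h0
    have : u₀ = 0 := congrArg Subtype.val h0
    simp [this] at hu₀
  obtain ⟨c, hc⟩ := (finrank_eq_one_iff_of_nonzero' _ hne).1 h1 ⟨u, hu'⟩
  have hc' : c • u₀ = u := congrArg Subtype.val hc
  have habs : |c| = 1 := by
    rw [← hc', norm_smul, hu₀, mul_one, Real.norm_eq_abs] at hu
    exact hu
  rcases eq_or_eq_neg_of_abs_eq habs with rfl | rfl
  · left; simpa using hc'.symm
  · right; simpa using hc'.symm

/-- The facet vector of `P` with respect to `ζ`: the sum of `(ζ(V(P, u)) / |h_P(u)|) u` over the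
outer unit normals `u` of the facets of `P` whose affine hull does not contain the origin. The
index set is finite, see `facetNormals_finite`. -/
def facetVector (ζ : ℝ≥0 → ℝ) (P : PolytopeIn n) : EuclideanSpace ℝ (Fin n) :=
  ∑ᶠ u ∈ P.facetNormals \ P.facetNormalsOrigin, (ζ (P.coneVolume u) / |P.supportFun u|) • u

/-- The valuation property on the space of all polytopes. -/
def IsValuation (Z : PolytopeIn n → EuclideanSpace ℝ (Fin n)) : Prop :=
  ∀ P Q U I : PolytopeIn n, U.carrier = P.carrier ∪ Q.carrier → I.carrier = P.carrier ∩ Q.carrier →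
    Z P + Z Q = Z U + Z I

/-- `SL(n)` contravariance: `Z (φ P) = φ⁻ᵗ Z (P)` for all `φ ∈ SL(n)`. -/
def IsSLContravariant (Z : PolytopeIn n → EuclideanSpace ℝ (Fin n)) : Prop :=
  ∀ (φ : Matrix.SpecialLinearGroup (Fin n) ℝ) (P : PolytopeIn n),
    Z (P.image φ.1) = Matrix.toEuclideanLin (φ.1⁻¹).transpose (Z P)

end PolytopeIn

/-- `ζ : [0, ∞) → ℝ` solves Cauchy's functional equation. -/
def IsCauchySolution (ζ : ℝ≥0 → ℝ) : Prop :=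
  ∀ x y : ℝ≥0, ζ (x + y) = ζ x + ζ y

end

/-!
A contravariant valuation is determined by its values on very few simplices, and on those it is
governed by one additive function for each of two types of simplex.

*Reduction.* Let `P` be given by finitely many inequalities `f ≤ b`. The hyperplanes through the
origin on which two of the normalised functionals `f / b` agree dissect `P` into cells, each of
which is, up to inclusion and exclusion, made of polytopes `G` whose affine hull misses the origin and of
pyramids `conv ({0} ∪ G)` (`IsPolytopeValuation.eq_zero_of_pyramids`). The same dissection from a
point of `G`, and induction on the dimension, replace `G` by simplices
(`IsPolytopeValuation.eq_zero_of_simplices`). So a valuation that vanishes on `conv t` and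
`conv ({0} ∪ t)` for all linearly independent `t` vanishes identically
(`IsPolytopeValuation.eq_zero_of_linearIndependent`). The dissections use that a bounded polyhedron
is a polytope and conversely (`IsPolyhedron.isConvexPolytope`, `IsConvexPolytope.isPolyhedron`).

*Values on simplices.* Identify `Z P` with the functional `⟨Z P, ·⟩`, so that contravariance reads
`⟨Z (φ P), φ x⟩ = ⟨Z P, x⟩`. If `t` is not a basis, the maps of determinant one that preserve `t`
force the value at both simplices to be zero
(`IsUnimodularContravariant.eq_zero_of_ncard_lt`). If `t` is a basis, the even permutations of `t`
show, as `n ≥ 3`, that the functional takes the same value at all members of `t`, and this value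
depends on `|det t|` only (`IsUnimodularContravariant.apply_eq_simplexValue`). Cutting an edge makes it
additive in `|det t|` (`IsUnimodularContravariant.simplexValue_add`).

*Comparison.* Facet vectors are contravariant valuations, direction by direction
(`PolytopeIn.isValuation_facetVector`, `PolytopeIn.isSLContravariant_facetVector`), and so are their
composites with `P ↦ conv ({0} ∪ P)`. For a basis `t` the facet vector for `ζ` is zero on `conv t`
(`PolytopeIn.facetVector_eq_zero_of_flat_simplex`), and on `conv ({0} ∪ t)` its inner product with
each member of `t` is `ζ` of the volume (`PolytopeIn.inner_facetVector_simplex`). Hence `ζ₂` can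
be fitted to `Z` on the simplices `conv t` and then `ζ₁` on the simplices `conv ({0} ∪ t)`, and the
difference of the two sides vanishes by the reduction.
-/

/-! ### Polytopes and polyhedra -/

open Topology Filter in
/-- A bounded set contains no ray: this is what forces the normalising functional of a cell of a
polytope to be positive there. -/
theorem Bornology.IsBounded.eq_zero_of_forall_add_smul_mem {E : Type*} [NormedAddCommGroup E]
    [NormedSpace ℝ E] {K : Set E} (hK : Bornology.IsBounded K) {z w : E}
    (h : ∀ r : ℝ, 0 ≤ r → z + r • w ∈ K) : w = 0 := by
  by_contra hw
  obtain ⟨C, hC⟩ := hK.exists_norm_le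
  have hw' : 0 < ‖w‖ := norm_pos_iff.2 hw
  have hC0 : 0 ≤ C := (norm_nonneg _).trans (hC _ (h 0 le_rfl))
  have h1 := hC _ (h ((C + ‖z‖ + 1) / ‖w‖) (by positivity))
  have h2 : ‖((C + ‖z‖ + 1) / ‖w‖) • w‖ = C + ‖z‖ + 1 := by
    rw [norm_smul, Real.norm_of_nonneg (by positivity), div_mul_cancel₀ _ hw'.ne']
  have h3 : ‖((C + ‖z‖ + 1) / ‖w‖) • w‖ ≤ ‖z + ((C + ‖z‖ + 1) / ‖w‖) • w‖ + ‖z‖ := by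
    simpa using norm_sub_le (z + ((C + ‖z‖ + 1) / ‖w‖) • w) z
  linarith

section Polyhedra

variable {E : Type*} [NormedAddCommGroup E] [NormedSpace ℝ E]

/-- A polytope in the wide sense: the convex hull of a finite, possibly empty, set. Admitting the
empty set makes the class closed under intersection. -/
def IsConvexPolytope (P : Set E) : Prop :=
  ∃ s : Set E, s.Finite ∧ convexHull ℝ s = P

/-- A finite intersection of closed half-spaces `{x | f x ≤ c}`, each given by a pair `(f, c)`. -/
def IsPolyhedron (K : Set E) : Prop :=
  ∃ S : Set ((E →ₗ[ℝ] ℝ) × ℝ), S.Finite ∧ K = {x | ∀ p ∈ S, p.1 x ≤ p.2}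

theorem IsPolyhedron.inter {K L : Set E} (hK : IsPolyhedron K) (hL : IsPolyhedron L) :
    IsPolyhedron (K ∩ L) := by
  obtain ⟨S, hS, rfl⟩ := hK
  obtain ⟨T, hT, rfl⟩ := hL
  refine ⟨S ∪ T, hS.union hT, ?_⟩
  ext x
  simp only [Set.mem_inter_iff, Set.mem_ofPred_eq, Set.mem_union]
  exact ⟨fun h p hp => hp.elim (h.1 p) (h.2 p), fun h => ⟨fun p hp => h p (.inl hp),
    fun p hp => h p (.inr hp)⟩⟩

theorem isPolyhedron_le (f : E →ₗ[ℝ] ℝ) (c : ℝ) : IsPolyhedron {x | f x ≤ c} :=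
  ⟨{(f, c)}, Set.finite_singleton _, by ext; simp⟩

theorem isPolyhedron_ge (f : E →ₗ[ℝ] ℝ) (c : ℝ) : IsPolyhedron {x | c ≤ f x} :=
  ⟨{(-f, -c)}, Set.finite_singleton _, by ext; simp⟩

theorem isPolyhedron_eq (f : E →ₗ[ℝ] ℝ) (c : ℝ) : IsPolyhedron {x | f x = c} := by
  have : {x | f x = c} = {x | f x ≤ c} ∩ {x | c ≤ f x} := by
    ext x; simp [le_antisymm_iff]
  rw [this]
  exact (isPolyhedron_le f c).inter (isPolyhedron_ge f c)

theorem IsPolyhedron.convex {K : Set E} (hK : IsPolyhedron K) : Convex ℝ K := by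
  obtain ⟨S, -, rfl⟩ := hK
  have : {x : E | ∀ p ∈ S, p.1 x ≤ p.2} = ⋂ p ∈ S, {x | p.1 x ≤ p.2} := by ext; simp
  rw [this]
  exact convex_iInter₂ fun p _ => convex_halfSpace_le p.1.isLinear p.2

/-- One step of Fourier–Motzkin elimination. -/
theorem IsPolyhedron.image_fst {K : Set (E × ℝ)} (hK : IsPolyhedron K) :
    IsPolyhedron (Prod.fst '' K) := by
  obtain ⟨S, hS, rfl⟩ := hK
  let a : ((E × ℝ →ₗ[ℝ] ℝ) × ℝ) → ℝ := fun p => p.1 (0, 1)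
  let g : ((E × ℝ →ₗ[ℝ] ℝ) × ℝ) → (E →ₗ[ℝ] ℝ) := fun p => p.1 ∘ₗ LinearMap.inl ℝ E ℝ
  have hsplit : ∀ (p : (E × ℝ →ₗ[ℝ] ℝ) × ℝ) y t, p.1 (y, t) = g p y + t * a p := by
    intro p y t
    have : ((y, t) : E × ℝ) = (y, 0) + t • (0, 1) := by simp
    rw [this, map_add, map_smul]; simp [g, a]
  refine ⟨(fun p => (g p, p.2)) '' {p ∈ S | a p = 0} ∪
    Set.image2 (fun p q => (a p • g q - a q • g p, a p * q.2 - a q * p.2))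
      {p ∈ S | 0 < a p} {q ∈ S | a q < 0},
    ((hS.subset (Set.sep_subset _ _)).image _).union
      (Set.Finite.image2 _ (hS.subset (Set.sep_subset _ _)) (hS.subset (Set.sep_subset _ _))), ?_⟩
  ext y
  constructor
  · rintro ⟨⟨y, t⟩, h, rfl⟩
    rintro _ (⟨p, ⟨hp, hp0⟩, rfl⟩ | ⟨p, ⟨hp, hp0⟩, q, ⟨hq, hq0⟩, rfl⟩)
    · have := h p hp
      rw [hsplit, hp0] at this
      simpa using this
    · have h1 := h p hp
      have h2 := h q hq
      rw [hsplit] at h1 h2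
      simp only [LinearMap.sub_apply, LinearMap.smul_apply, smul_eq_mul]
      nlinarith [mul_le_mul_of_nonneg_left h2 hp0.le,
        mul_le_mul_of_nonneg_left h1 (neg_nonneg.2 hq0.le)]
  · intro h
    have h0 : ∀ p ∈ S, a p = 0 → g p y ≤ p.2 := fun p hp hp0 =>
      h (g p, p.2) (.inl ⟨p, ⟨hp, hp0⟩, rfl⟩)
    have h1 : ∀ p ∈ S, 0 < a p → ∀ q ∈ S, a q < 0 →
        (q.2 - g q y) / a q ≤ (p.2 - g p y) / a p := by
      intro p hp hp0 q hq hq0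
      have := h _ (.inr ⟨p, ⟨hp, hp0⟩, q, ⟨hq, hq0⟩, rfl⟩)
      simp only [LinearMap.sub_apply, LinearMap.smul_apply, smul_eq_mul] at this
      rw [div_le_iff_of_neg hq0, div_mul_eq_mul_div, div_le_iff₀ hp0]
      linarith
    suffices ∃ t : ℝ, (∀ p ∈ S, 0 < a p → t ≤ (p.2 - g p y) / a p) ∧
        ∀ q ∈ S, a q < 0 → (q.2 - g q y) / a q ≤ t by
      obtain ⟨t, ht1, ht2⟩ := this
      refine ⟨(y, t), fun p hp => ?_, rfl⟩
      rw [hsplit]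
      rcases lt_trichotomy (a p) 0 with hp0 | hp0 | hp0
      · have := ht2 p hp hp0
        rw [div_le_iff_of_neg hp0] at this
        linarith
      · rw [hp0]; simpa using h0 p hp hp0
      · have := ht1 p hp hp0
        rw [le_div_iff₀ hp0] at this
        linarith
    by_cases hne : {q ∈ S | a q < 0}.Nonempty
    · obtain ⟨q, hq, hmax⟩ := Set.exists_max_image {q ∈ S | a q < 0}
        (fun q => (q.2 - g q y) / a q) (hS.subset (Set.sep_subset _ _)) hne
      exact ⟨(q.2 - g q y) / a q, fun p hp hp0 => h1 p hp hp0 q hq.1 hq.2,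
        fun q' hq' hq0' => hmax q' ⟨hq', hq0'⟩⟩
    · have hno : ∀ q ∈ S, a q < 0 → False := fun q hq hq0 => hne ⟨q, hq, hq0⟩
      by_cases hne' : {p ∈ S | 0 < a p}.Nonempty
      · obtain ⟨p, hp, hmin⟩ := Set.exists_min_image {p ∈ S | 0 < a p}
          (fun q => (q.2 - g q y) / a q) (hS.subset (Set.sep_subset _ _)) hne'
        exact ⟨(p.2 - g p y) / a p, fun q hq hq0 => hmin q ⟨hq, hq0⟩,
          fun q hq hq0 => (hno q hq hq0).elim⟩
      · exact ⟨0, fun p hp hp0 => (hne' ⟨p, hp, hp0⟩).elim, fun q hq hq0 => (hno q hq hq0).elim⟩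

theorem IsConvexPolytope.isCompact {P : Set E} (hP : IsConvexPolytope P) : IsCompact P := by
  obtain ⟨s, hs, rfl⟩ := hP
  exact hs.isCompact_convexHull ℝ

theorem IsConvexPolytope.convex {P : Set E} (hP : IsConvexPolytope P) : Convex ℝ P := by
  obtain ⟨s, hs, rfl⟩ := hP
  exact convex_convexHull ℝ s

theorem isPolyhedron_empty : IsPolyhedron (∅ : Set E) :=
  ⟨{(0, -1)}, Set.finite_singleton _, by ext; simp⟩

theorem isPolyhedron_singleton [FiniteDimensional ℝ E] (x : E) : IsPolyhedron ({x} : Set E) := by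
  let b := Module.finBasis ℝ E
  refine ⟨Set.range (fun i => (b.coord i, b.coord i x)) ∪
    Set.range (fun i => (-b.coord i, -b.coord i x)),
    (Set.finite_range _).union (Set.finite_range _), ?_⟩
  ext y
  constructor
  · rintro rfl _ (⟨i, rfl⟩ | ⟨i, rfl⟩) <;> simp
  · intro h
    refine b.ext_elem fun i => le_antisymm (h _ (.inl ⟨i, rfl⟩)) ?_
    simpa using h _ (.inr ⟨i, rfl⟩)

/-- Every polytope is an intersection of half-spaces. A point is added to the generating set by
realising the join as the projection of a polyhedron in one more variable. -/
theorem IsConvexPolytope.isPolyhedron [FiniteDimensional ℝ E] {P : Set E}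
    (hP : IsConvexPolytope P) : IsPolyhedron P := by
  obtain ⟨s, hs, rfl⟩ := hP
  induction s, hs using Set.Finite.induction_on with
  | empty => rw [convexHull_empty]; exact isPolyhedron_empty
  | @insert x s _ hs ih =>
    rcases s.eq_empty_or_nonempty with rfl | hne
    · simpa using isPolyhedron_singleton x
    have hb := (hs.isCompact_convexHull ℝ).isBounded
    obtain ⟨S, hS, hK⟩ := ih
    have key : convexHull ℝ (insert x s) = Prod.fst '' {z : E × ℝ | ∀ q ∈
        insert (LinearMap.snd ℝ E ℝ, (1 : ℝ)) (insert (-LinearMap.snd ℝ E ℝ, (0 : ℝ))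
        ((fun p : (E →ₗ[ℝ] ℝ) × ℝ => (p.1 ∘ₗ LinearMap.fst ℝ E ℝ +
          (p.1 x - p.2) • LinearMap.snd ℝ E ℝ, p.1 x)) '' S)), q.1 z ≤ q.2} := by
      ext y
      constructor
      · rw [convexHull_insert hne, mem_convexJoin]
        rintro ⟨_, rfl, z, hz, a, b, ha, hb, hab, rfl⟩
        refine ⟨(_, b), ?_, rfl⟩
        rintro q (rfl | rfl | ⟨p, hp, rfl⟩)
        · simp; linarith
        · simpa using hb
        · rw [hK] at hz
          have := mul_le_mul_of_nonneg_left (hz p hp) hb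
          obtain rfl : a = 1 - b := by linarith
          simp
          linarith
      · rintro ⟨⟨y, t⟩, h, rfl⟩
        have ht1 : t ≤ 1 := by simpa using h _ (.inl rfl)
        have ht0 : 0 ≤ t := by simpa using h _ (.inr (.inl rfl))
        have hf : ∀ p ∈ S, p.1 y + (p.1 x - p.2) * t ≤ p.1 x := fun p hp => by
          simpa using h _ (.inr (.inr ⟨p, hp, rfl⟩))
        rcases ht0.eq_or_lt with rfl | ht
        · obtain ⟨z, hz⟩ := hne
          have : y - x = 0 := by
            refine hb.eq_zero_of_forall_add_smul_mem (z := z) fun r hr => ?_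
            have hz' := subset_convexHull ℝ s hz
            rw [hK] at hz' ⊢
            intro p hp
            have h1 := hz' p hp
            have h2 := hf p hp
            simp only [map_add, map_smul, map_sub, smul_eq_mul]
            nlinarith [mul_nonneg hr (sub_nonneg.2 (show p.1 y ≤ p.1 x by simpa using h2))]
          rw [sub_eq_zero.1 this]
          exact subset_convexHull ℝ _ (Set.mem_insert _ _)
        · have hz : t⁻¹ • (y - (1 - t) • x) ∈ convexHull ℝ s := by
            rw [hK]
            intro p hp
            have := hf p hp
            simp only [map_smul, map_sub, smul_eq_mul]
            rw [inv_mul_le_iff₀ ht]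
            linarith
          have hy : y = (1 - t) • x + t • (t⁻¹ • (y - (1 - t) • x)) := by
            rw [smul_inv_smul₀ ht.ne']; abel
          rw [hy]
          exact convex_convexHull ℝ _ (subset_convexHull ℝ _ (Set.mem_insert _ _))
            (convexHull_mono (Set.subset_insert _ _) hz) (by linarith) ht0 (by ring)
    rw [key]
    exact IsPolyhedron.image_fst ⟨_, ((hS.image _).insert _).insert _, rfl⟩

open Topology Filter in
/-- A compact polyhedron is a polytope: an extreme point is determined by the constraints that are
active there, so there are finitely many of them, and Krein–Milman applies. -/
theorem IsPolyhedron.isConvexPolytope {K : Set E} (hK : IsPolyhedron K) (hc : IsCompact K) :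
    IsConvexPolytope K := by
  have hconv := hK.convex
  obtain ⟨S, hS, rfl⟩ := hK
  set K := {x : E | ∀ p ∈ S, p.1 x ≤ p.2} with hKdef
  have hfin : (K.extremePoints ℝ).Finite := by
    refine Set.Finite.of_injOn (f := fun x => {p ∈ S | p.1 x = p.2}) (t := {T | T ⊆ S})
      (fun x _ => Set.sep_subset _ _) ?_ hS.finite_subsets
    intro x hx y hy hxy
    have hact : ∀ p ∈ S, p.1 x = p.2 → p.1 y = p.2 := fun p hp h =>
      ((Set.ext_iff.1 hxy p).1 ⟨hp, h⟩).2
    have hev : ∀ᶠ ε : ℝ in 𝓝[>] 0, ∀ p ∈ S, p.1 (x + ε • (x - y)) ≤ p.2 := by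
      rw [hS.eventually_all]
      intro p hp
      rcases (hx.1 p hp).eq_or_lt with h | h
      · refine Eventually.of_forall fun ε => ?_
        simp [h, hact p hp h]
      · have : Tendsto (fun ε : ℝ => p.1 (x + ε • (x - y))) (𝓝 0) (𝓝 (p.1 x)) := by
          have : Continuous fun ε : ℝ => p.1 x + ε * p.1 (x - y) := by fun_prop
          simpa using this.tendsto 0
        exact ((this.eventually (gt_mem_nhds h)).filter_mono nhdsWithin_le_nhds).mono
          fun _ h => le_of_lt h
    obtain ⟨ε, hε, hε0⟩ := (hev.and self_mem_nhdsWithin).exists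
    have hε0 : (0 : ℝ) < ε := hε0
    refine (((mem_extremePoints.1 hx).2 _ hε y hy.1
      ⟨1 / (1 + ε), ε / (1 + ε), by positivity, by positivity, by field_simp, ?_⟩).2).symm
    have : (1 + ε) ≠ 0 := by positivity
    match_scalars <;> (field_simp; try ring)
  refine ⟨_, hfin, ?_⟩
  rw [← (hfin.isClosed_convexHull ℝ).closure_eq, closure_convexHull_extremePoints hc hconv]

theorem IsConvexPolytope.inter_isPolyhedron [FiniteDimensional ℝ E] {P K : Set E}
    (hP : IsConvexPolytope P) (hK : IsPolyhedron K) : IsConvexPolytope (P ∩ K) := by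
  refine (hP.isPolyhedron.inter hK).isConvexPolytope (hP.isCompact.inter_right ?_)
  obtain ⟨S, -, rfl⟩ := hK
  have : {x : E | ∀ p ∈ S, p.1 x ≤ p.2} = ⋂ p ∈ S, {x | p.1 x ≤ p.2} := by ext; simp
  rw [this]
  exact isClosed_biInter fun p _ => isClosed_le (LinearMap.continuous_of_finiteDimensional _)
    continuous_const

theorem IsConvexPolytope.inter [FiniteDimensional ℝ E] {P Q : Set E}
    (hP : IsConvexPolytope P) (hQ : IsConvexPolytope Q) :
    IsConvexPolytope (P ∩ Q) :=
  hP.inter_isPolyhedron hQ.isPolyhedron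

theorem IsConvexPolytope.join {P : Set E} (hP : IsConvexPolytope P) (v : E) :
    IsConvexPolytope (convexHull ℝ (insert v P)) := by
  obtain ⟨s, hs, rfl⟩ := hP
  refine ⟨insert v s, hs.insert v, ?_⟩
  refine Set.Subset.antisymm
    (convexHull_mono (Set.insert_subset_insert (subset_convexHull ℝ s)))
    (convexHull_min (Set.insert_subset ?_ ?_) (convex_convexHull ℝ _))
  · exact subset_convexHull ℝ _ (Set.mem_insert v s)
  · exact convexHull_mono (Set.subset_insert v s)

end Polyhedra

/-! ### Valuations on polytopes and dissections -/

section Joins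

variable {E : Type*} [AddCommGroup E] [Module ℝ E]

theorem Convex.mem_convexHull_insert_iff {G : Set E} (hG : Convex ℝ G) {v x : E} :
    x ∈ convexHull ℝ (insert v G) ↔
      x = v ∨ ∃ y ∈ G, ∃ t : ℝ, 0 < t ∧ t ≤ 1 ∧ x = v + t • (y - v) := by
  rcases G.eq_empty_or_nonempty with rfl | hne
  · simp
  rw [convexHull_insert hne, hG.convexHull_eq, mem_convexJoin]
  constructor
  · rintro ⟨_, rfl, y, hy, a, t, ha, ht, hat, rfl⟩
    obtain rfl : a = 1 - t := by linarith
    rcases ht.eq_or_lt with rfl | ht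
    · left; simp
    · right
      exact ⟨y, hy, t, ht, by linarith, by module⟩
  · rintro (rfl | ⟨y, hy, t, ht, ht1, rfl⟩)
    · obtain ⟨y, hy⟩ := hne
      exact ⟨x, rfl, y, hy, left_mem_segment ℝ _ _⟩
    · exact ⟨v, rfl, y, hy, 1 - t, t, by linarith, ht.le, by ring, by module⟩

theorem Convex.mem_convexHull_insert_zero_iff {G : Set E} (hG : Convex ℝ G) {x : E} :
    x ∈ convexHull ℝ (insert 0 G) ↔ x = 0 ∨ ∃ y ∈ G, ∃ t : ℝ, 0 < t ∧ t ≤ 1 ∧ x = t • y := by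
  rw [hG.mem_convexHull_insert_iff]
  simp

theorem convexHull_insert_union {P Q : Set E} (hP : Convex ℝ P) (hQ : Convex ℝ Q)
    (hPQ : Convex ℝ (P ∪ Q)) (v : E) : convexHull ℝ (insert v (P ∪ Q)) =
      convexHull ℝ (insert v P) ∪ convexHull ℝ (insert v Q) := by
  ext x
  rw [Set.mem_union, hPQ.mem_convexHull_insert_iff, hP.mem_convexHull_insert_iff,
    hQ.mem_convexHull_insert_iff]
  constructor
  · rintro (h | ⟨y, hy | hy, h⟩)
    · exact .inl (.inl h)
    · exact .inl (.inr ⟨y, hy, h⟩)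
    · exact .inr (.inr ⟨y, hy, h⟩)
  · rintro ((h | ⟨y, hy, h⟩) | (h | ⟨y, hy, h⟩))
    · exact .inl h
    · exact .inr ⟨y, .inl hy, h⟩
    · exact .inl h
    · exact .inr ⟨y, .inr hy, h⟩

/-- A segment covered by two closed sets, one containing each end, meets their intersection. -/
theorem exists_mem_segment_inter [TopologicalSpace E] [IsTopologicalAddGroup E]
    [ContinuousSMul ℝ E] {P Q : Set E} (hP : IsClosed P) (hQ : IsClosed Q) {p q : E} (hp : p ∈ P)
    (hq : q ∈ Q) (h : segment ℝ p q ⊆ P ∪ Q) : ∃ r ∈ segment ℝ p q, r ∈ P ∩ Q :=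
  isPreconnected_closed_iff.1 (convex_segment p q).isPreconnected P Q hP hQ h
    ⟨p, left_mem_segment ℝ _ _, hp⟩ ⟨q, right_mem_segment ℝ _ _, hq⟩

/-- Joins with a fixed point commute with intersections of convex sets whose union is convex: on a
ray through `v` that meets `P` and `Q`, a point of `P ∩ Q` lies between the two. -/
theorem convexHull_insert_inter [TopologicalSpace E] [IsTopologicalAddGroup E]
    [ContinuousSMul ℝ E] {P Q : Set E} (hP : Convex ℝ P) (hQ : Convex ℝ Q)
    (hPc : IsClosed P) (hQc : IsClosed Q)
    (hPQ : Convex ℝ (P ∪ Q)) (v : E) : convexHull ℝ (insert v (P ∩ Q)) =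
      convexHull ℝ (insert v P) ∩ convexHull ℝ (insert v Q) := by
  ext x
  rw [Set.mem_inter_iff, (hP.inter hQ).mem_convexHull_insert_iff, hP.mem_convexHull_insert_iff,
    hQ.mem_convexHull_insert_iff]
  constructor
  · rintro (h | ⟨y, hy, h⟩)
    · exact ⟨.inl h, .inl h⟩
    · exact ⟨.inr ⟨y, hy.1, h⟩, .inr ⟨y, hy.2, h⟩⟩
  · rintro ⟨h | ⟨p, hp, s, hs0, hs1, hs⟩, h' | ⟨q, hq, t, ht0, ht1, ht⟩⟩
    · exact .inl h
    · exact .inl h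
    · exact .inl h'
    · right
      obtain ⟨r, ⟨a, b, ha, hb, hab, rfl⟩, hr⟩ := exists_mem_segment_inter hPc hQc hp hq
        (hPQ.segment_subset (.inl hp) (.inr hq))
      have hpv : p = v + s⁻¹ • (x - v) := by
        rw [hs, add_sub_cancel_left, inv_smul_smul₀ hs0.ne']; abel
      have hqv : q = v + t⁻¹ • (x - v) := by
        rw [ht, add_sub_cancel_left, inv_smul_smul₀ ht0.ne']; abel
      have hs' : 1 ≤ s⁻¹ := (one_le_inv₀ hs0).2 hs1
      have ht' : 1 ≤ t⁻¹ := (one_le_inv₀ ht0).2 ht1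
      have he : 1 ≤ a * s⁻¹ + b * t⁻¹ := by nlinarith
      have he0 : 0 < a * s⁻¹ + b * t⁻¹ := by linarith
      refine ⟨_, hr, (a * s⁻¹ + b * t⁻¹)⁻¹, inv_pos.2 he0, inv_le_one_of_one_le₀ he, ?_⟩
      have : a • p + b • q - v = (a * s⁻¹ + b * t⁻¹) • (x - v) := by
        obtain rfl : a = 1 - b := by linarith
        rw [hpv, hqv]; module
      rw [this, inv_smul_smul₀ he0.ne']; abel

end Joins

section Valuations

open scoped Pointwise

variable {E G : Type*} [NormedAddCommGroup E] [NormedSpace ℝ E]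
  [AddCommGroup G]

/-- A valuation on the polytopes, the empty one included, of a real vector space. It is a function
on all sets, with no condition on its values outside the polytopes. -/
structure IsPolytopeValuation (Z : Set E → G) : Prop where
  empty : Z ∅ = 0
  add : ∀ ⦃P Q : Set E⦄, IsConvexPolytope P → IsConvexPolytope Q → IsConvexPolytope (P ∪ Q) →
    Z P + Z Q = Z (P ∪ Q) + Z (P ∩ Q)

namespace IsPolytopeValuation

variable {Z : Set E → G}

/-- Joining with a fixed point `v` turns a valuation into a valuation, up to the constant that
corrects the value at the empty set. -/
theorem join (hZ : IsPolytopeValuation Z) (v : E) :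
    IsPolytopeValuation fun Q => Z (convexHull ℝ (insert v Q)) - Z {v} where
  empty := by simp
  add P Q hP hQ hPQ := by
    have hu := convexHull_insert_union hP.convex hQ.convex hPQ.convex v
    have h := hZ.add (hP.join v) (hQ.join v) (hu ▸ hPQ.join v)
    rw [← hu, ← convexHull_insert_inter hP.convex hQ.convex hP.isCompact.isClosed
      hQ.isCompact.isClosed hPQ.convex v] at h
    rw [sub_add_sub_comm, h, sub_add_sub_comm]

theorem _root_.IsConvexPolytope.vadd {P : Set E} (hP : IsConvexPolytope P) (v : E) :
    IsConvexPolytope (v +ᵥ P) := by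
  obtain ⟨s, hs, rfl⟩ := hP
  exact ⟨v +ᵥ s, hs.vadd_set, convexHull_vadd v s⟩

theorem translate (hZ : IsPolytopeValuation Z) (v : E) :
    IsPolytopeValuation fun Q => Z (v +ᵥ Q) where
  empty := by simpa using hZ.empty
  add P Q hP hQ hPQ := by
    have := hZ.add (hP.vadd v) (hQ.vadd v) (by rw [← Set.vadd_set_union]; exact hPQ.vadd v)
    rwa [← Set.vadd_set_union, ← Set.vadd_set_inter] at this

variable [FiniteDimensional ℝ E]

/-- Dissection of a polytope by the hyperplanes of a finite family `L` of linear functionals. The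
cells, together with their common faces, are cut out by cones on which each functional of `L` has
constant weak sign. -/
theorem eq_zero_of_cells (hZ : IsPolytopeValuation Z) {P : Set E} (hP : IsConvexPolytope P)
    {L : Set (E →ₗ[ℝ] ℝ)} (hL : L.Finite) (T : Set (E →ₗ[ℝ] ℝ)) (hT : T.Finite)
    (h : ∀ T' : Set (E →ₗ[ℝ] ℝ), T'.Finite → T ⊆ T' →
      (∀ g ∈ L, (∀ x, (∀ f ∈ T', f x ≤ 0) → g x ≤ 0) ∨ ∀ x, (∀ f ∈ T', f x ≤ 0) → 0 ≤ g x) →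
      Z (P ∩ {x | ∀ f ∈ T', f x ≤ 0}) = 0) :
    Z (P ∩ {x | ∀ f ∈ T, f x ≤ 0}) = 0 := by
  induction L, hL using Set.Finite.induction_on generalizing T with
  | empty => exact h T hT subset_rfl (by simp)
  | @insert g L _ hL ih =>
    have cone : ∀ T : Set (E →ₗ[ℝ] ℝ), T.Finite →
        IsConvexPolytope (P ∩ {x | ∀ f ∈ T, f x ≤ 0}) := fun T hT =>
      hP.inter_isPolyhedron ⟨(fun f => (f, 0)) '' T, hT.image _, by ext; simp⟩
    have step : ∀ U : Set (E →ₗ[ℝ] ℝ), U.Finite → T ⊆ U → (g ∈ U ∨ -g ∈ U) →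
        Z (P ∩ {x | ∀ f ∈ U, f x ≤ 0}) = 0 := by
      intro U hU hTU hg
      refine ih U hU fun T' hT' hUT' hres => h T' hT' (hTU.trans hUT') ?_
      rintro f (rfl | hf)
      · refine hg.imp (fun hg x hx => hx _ (hUT' hg)) fun hg x hx => ?_
        simpa using hx _ (hUT' hg)
      · exact hres f hf
    have h1 := step (insert g T) (hT.insert _) (Set.subset_insert _ _) (.inl (Set.mem_insert _ _))
    have h2 := step (insert (-g) T) (hT.insert _) (Set.subset_insert _ _)
      (.inr (Set.mem_insert _ _))
    have h3 := step (insert g (insert (-g) T)) ((hT.insert _).insert _)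
      ((Set.subset_insert _ _).trans (Set.subset_insert _ _)) (.inl (Set.mem_insert _ _))
    have hunion : (P ∩ {x | ∀ f ∈ insert g T, f x ≤ 0}) ∪ (P ∩ {x | ∀ f ∈ insert (-g) T, f x ≤ 0})
        = P ∩ {x | ∀ f ∈ T, f x ≤ 0} := by
      ext x
      have := le_total (g x) 0
      simp only [Set.mem_union, Set.mem_inter_iff, Set.mem_ofPred_eq, Set.forall_mem_insert,
        LinearMap.neg_apply, neg_nonpos]
      tauto
    have hinter : (P ∩ {x | ∀ f ∈ insert g T, f x ≤ 0}) ∩ (P ∩ {x | ∀ f ∈ insert (-g) T, f x ≤ 0})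
        = P ∩ {x | ∀ f ∈ insert g (insert (-g) T), f x ≤ 0} := by
      ext x
      simp only [Set.mem_inter_iff, Set.mem_ofPred_eq, Set.forall_mem_insert]
      tauto
    have := hZ.add (cone _ (hT.insert g)) (cone _ (hT.insert (-g))) (hunion ▸ cone T hT)
    rw [hunion, hinter, h1, h2, h3, add_zero, add_zero] at this
    exact this.symm

theorem _root_.notMem_affineSpan_of_forall_eq_one {E : Type*} [AddCommGroup E] [Module ℝ E]
    {G : Set E} (m : E →ₗ[ℝ] ℝ) (h : ∀ x ∈ G, m x = 1) : (0 : E) ∉ affineSpan ℝ G := by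
  intro h0
  have h1 : m.toAffineMap 0 ∈ (affineSpan ℝ G).map m.toAffineMap :=
    AffineSubspace.mem_map_of_mem _ h0
  rw [AffineSubspace.map_span] at h1
  have h2 : m.toAffineMap '' G ⊆ {1} := by
    rintro _ ⟨x, hx, rfl⟩
    exact h x hx
  have h3 := affineSpan_mono ℝ h2 h1
  simp at h3

/-- A finite family of functionals that is totally ordered on a set has a largest element there. -/
theorem _root_.exists_forall_le_of_total {α ι : Type*} (C : Set α) (h : ι → α → ℝ) {I : Set ι}
    (hI : I.Finite) (hne : I.Nonempty)
    (htot : ∀ i ∈ I, ∀ j ∈ I, (∀ x ∈ C, h i x ≤ h j x) ∨ ∀ x ∈ C, h j x ≤ h i x) :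
    ∃ m ∈ I, ∀ i ∈ I, ∀ x ∈ C, h i x ≤ h m x := by
  induction I, hI using Set.Finite.induction_on with
  | empty => simp at hne
  | @insert a I _ hI ih =>
    rcases I.eq_empty_or_nonempty with rfl | hne'
    · exact ⟨a, by simp, by simp⟩
    obtain ⟨m, hm, hmax⟩ := ih hne' fun i hi j hj => htot i (.inr hi) j (.inr hj)
    rcases htot a (.inl rfl) m (.inr hm) with h1 | h1
    · refine ⟨m, .inr hm, ?_⟩
      rintro i (rfl | hi)
      exacts [h1, hmax i hi]
    · refine ⟨a, .inl rfl, ?_⟩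
      rintro i (rfl | hi) x hx
      exacts [le_rfl, (hmax i hi x hx).trans (h1 x hx)]

/-- A valuation that vanishes on all polytopes `G` inside `P` whose affine hull misses the origin,
and on the pyramids over them with apex at the origin, vanishes on `P`.

Write `P` as `{x | f x ≤ b}` over finitely many pairs `(f, b)` and cut it by the hyperplanes through
the origin on which two of the functionals `f / b`, `b ≠ 0`, agree. In a cell `R` let `m` be the
largest of the functionals with `b > 0` and `j` the smallest of those with `b < 0`. The pyramid over
`R ∩ {m = 1}` is the union of `R` and the pyramid over `R ∩ {j = 1}`, and these two sets meet in
`R ∩ {j = 1}`. If there is no `b < 0`, then `R` is itself a pyramid, and if there is no `b > 0`,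
then `R` is contained in `{0}`. -/
theorem eq_zero_of_pyramids (hZ : IsPolytopeValuation Z) {P : Set E} (hP : IsConvexPolytope P)
    (h : ∀ G ⊆ P, IsConvexPolytope G → (0 : E) ∉ affineSpan ℝ G →
      Z G = 0 ∧ Z (convexHull ℝ (insert 0 G)) = 0) : Z P = 0 := by
  obtain ⟨S, hS, hPS⟩ := hP.isPolyhedron
  let H : ((E →ₗ[ℝ] ℝ) × ℝ) → (E →ₗ[ℝ] ℝ) := fun p => p.2⁻¹ • p.1
  suffices hcells : Z (P ∩ {x | ∀ f ∈ (∅ : Set (E →ₗ[ℝ] ℝ)), f x ≤ 0}) = 0 by simpa using hcells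
  refine hZ.eq_zero_of_cells hP (L := Set.image2 (fun p q => H p - H q) S S)
    (Set.Finite.image2 _ hS hS) ∅ Set.finite_empty fun T hT _ hres => ?_
  set C := {x : E | ∀ f ∈ T, f x ≤ 0} with hC
  have hCsmul : ∀ x ∈ C, ∀ t : ℝ, 0 ≤ t → t • x ∈ C := fun x hx t ht f hf => by
    rw [map_smul, smul_eq_mul]; exact mul_nonpos_of_nonneg_of_nonpos ht (hx f hf)
  have hC0 : (0 : E) ∈ C := fun f _ => by simp
  have hRpoly : IsConvexPolytope (P ∩ C) :=
    hP.inter_isPolyhedron ⟨(fun f => (f, 0)) '' T, hT.image _, by ext; simp [C]⟩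
  have htot : ∀ p ∈ S, ∀ q ∈ S, (∀ x ∈ C, H p x ≤ H q x) ∨ ∀ x ∈ C, H q x ≤ H p x := by
    intro p hp q hq
    refine (hres _ ⟨p, hp, q, hq, rfl⟩).imp (fun h x hx => ?_) fun h x hx => ?_
    · simpa using h x hx
    · simpa using h x hx
  have hb := hP.isCompact.isBounded
  have hmemP : ∀ x, x ∈ P ↔ (∀ p ∈ S, 0 < p.2 → H p x ≤ 1) ∧ (∀ p ∈ S, p.2 = 0 → p.1 x ≤ 0) ∧
      ∀ p ∈ S, p.2 < 0 → 1 ≤ H p x := by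
    intro x
    have hpos : ∀ p : (E →ₗ[ℝ] ℝ) × ℝ, 0 < p.2 → (H p x ≤ 1 ↔ p.1 x ≤ p.2) := fun p hp => by
      simp [H, inv_mul_le_iff₀ hp]
    have hneg : ∀ p : (E →ₗ[ℝ] ℝ) × ℝ, p.2 < 0 → (1 ≤ H p x ↔ p.1 x ≤ p.2) := fun p hp => by
      simp only [H, LinearMap.smul_apply, smul_eq_mul]
      rw [mul_comm, ← div_eq_mul_inv, le_div_iff_of_neg hp, one_mul]
    rw [hPS]
    constructor
    · exact fun hx => ⟨fun p hp hp0 => (hpos p hp0).2 (hx p hp), fun p hp hp0 => hp0 ▸ hx p hp,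
        fun p hp hp0 => (hneg p hp0).2 (hx p hp)⟩
    · rintro ⟨h1, h2, h3⟩ p hp
      rcases lt_trichotomy p.2 0 with hp0 | hp0 | hp0
      · exact (hneg p hp0).1 (h3 p hp hp0)
      · rw [hp0]; exact h2 p hp hp0
      · exact (hpos p hp0).1 (h1 p hp hp0)
  -- A ray of `C` on which no functional with positive bound increases would stay in `P`.
  have hray : ∀ x ∈ P ∩ C, (∀ p ∈ S, 0 < p.2 → H p x ≤ 0) → x = 0 := by
    rintro x ⟨hxP, hxC⟩ hx
    refine hb.eq_zero_of_forall_add_smul_mem (z := x) fun r hr => ?_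
    obtain ⟨-, h2, h3⟩ := (hmemP x).1 hxP
    rw [show x + r • x = (1 + r) • x by module, hmemP]
    simp only [map_smul, smul_eq_mul]
    refine ⟨fun p hp hp0 => ?_, fun p hp hp0 => ?_, fun p hp hp0 => ?_⟩
    · nlinarith [hx p hp hp0]
    · nlinarith [h2 p hp hp0]
    · nlinarith [h3 p hp hp0]
  have hzero : Z {0} = 0 := by
    have := (h ∅ (Set.empty_subset _) ⟨∅, Set.finite_empty, by simp⟩
      (by simpa using AffineSubspace.notMem_bot ℝ E 0)).2
    simpa using this
  by_cases hpos : {p ∈ S | 0 < p.2}.Nonempty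
  swap
  · have hR : P ∩ C ⊆ {0} := fun x hx => hray x hx fun p hp hp0 => (hpos ⟨p, hp, hp0⟩).elim
    rcases Set.subset_singleton_iff_eq.1 hR with hR | hR <;> rw [hR]
    exacts [hZ.empty, hzero]
  obtain ⟨pm, ⟨hpm, hpm0⟩, hmax⟩ := exists_forall_le_of_total C (fun p => H p)
    (hS.subset (Set.sep_subset _ _)) hpos fun p hp q hq => htot p hp.1 q hq.1
  set m := H pm with hm
  have hup : ∀ x ∈ P ∩ C, x ≠ 0 → 0 < m x ∧ m x ≤ 1 ∧ (m x)⁻¹ • x ∈ P ∩ C := by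
    rintro x hx hx0
    obtain ⟨h1, h2, h3⟩ := (hmemP x).1 hx.1
    have hmx : 0 < m x := by
      by_contra hmx
      exact hx0 (hray x hx fun p hp hp0 => (hmax p ⟨hp, hp0⟩ x hx.2).trans (not_lt.1 hmx))
    have hmx1 : m x ≤ 1 := h1 pm hpm hpm0
    refine ⟨hmx, hmx1, (hmemP _).2 ?_, hCsmul x hx.2 _ (inv_pos.2 hmx).le⟩
    simp only [map_smul, smul_eq_mul, inv_mul_le_iff₀ hmx, le_inv_mul_iff₀ hmx, mul_one, mul_zero]
    exact ⟨fun p hp hp0 => hmax p ⟨hp, hp0⟩ x hx.2, h2, fun p hp hp0 => hmx1.trans (h3 p hp hp0)⟩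
  have hslice : ∀ f : E →ₗ[ℝ] ℝ, IsConvexPolytope (P ∩ C ∩ {x | f x = 1}) ∧
      Z (P ∩ C ∩ {x | f x = 1}) = 0 ∧
      Z (convexHull ℝ (insert 0 (P ∩ C ∩ {x | f x = 1}))) = 0 := fun f =>
    ⟨hRpoly.inter_isPolyhedron (isPolyhedron_eq f 1),
      h _ (Set.inter_subset_left.trans Set.inter_subset_left)
      (hRpoly.inter_isPolyhedron (isPolyhedron_eq f 1))
      (notMem_affineSpan_of_forall_eq_one f fun x hx => hx.2)⟩
  obtain ⟨hG1, hZG1, hZA⟩ := hslice m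
  have hRsub : P ∩ C ⊆ convexHull ℝ (insert 0 (P ∩ C ∩ {x | m x = 1})) := by
    intro x hx
    rw [hG1.convex.mem_convexHull_insert_zero_iff]
    by_cases hx0 : x = 0
    · exact .inl hx0
    obtain ⟨h1, h2, h3⟩ := hup x hx hx0
    exact .inr ⟨(m x)⁻¹ • x, ⟨h3, by simp [h1.ne']⟩, m x, h1, h2, (smul_inv_smul₀ h1.ne' x).symm⟩
  by_cases hneg : {p ∈ S | p.2 < 0}.Nonempty
  swap
  · have hR0 : (0 : E) ∈ P ∩ C := by
      refine ⟨(hmemP 0).2 ⟨?_, ?_, fun p hp hp0 => (hneg ⟨p, hp, hp0⟩).elim⟩, hC0⟩ <;> simp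
    have hRA : P ∩ C = convexHull ℝ (insert 0 (P ∩ C ∩ {x | m x = 1})) :=
      hRsub.antisymm (convexHull_min (Set.insert_subset hR0 Set.inter_subset_left) hRpoly.convex)
    rw [hRA, hZA]
  obtain ⟨pj, ⟨hpj, hpj0⟩, hmin⟩ := exists_forall_le_of_total C (fun p x => -(H p x))
    (hS.subset (Set.sep_subset _ _)) hneg fun p hp q hq => by
      simpa [or_comm] using htot p hp.1 q hq.1
  simp only [neg_le_neg_iff] at hmin
  set j := H pj with hj
  obtain ⟨hG2, hZG2, hZB⟩ := hslice j
  have hj1 : ∀ x ∈ P ∩ C, 1 ≤ j x := fun x hx => ((hmemP x).1 hx.1).2.2 pj hpj hpj0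
  have hunion : P ∩ C ∪ convexHull ℝ (insert 0 (P ∩ C ∩ {x | j x = 1})) =
      convexHull ℝ (insert 0 (P ∩ C ∩ {x | m x = 1})) := by
    apply Set.Subset.antisymm
    · refine Set.union_subset hRsub (convexHull_min (Set.insert_subset ?_ ?_)
        (convex_convexHull ℝ _))
      · exact subset_convexHull ℝ _ (Set.mem_insert _ _)
      · exact Set.inter_subset_left.trans hRsub
    · intro x hx
      rw [Set.mem_union, hG2.convex.mem_convexHull_insert_zero_iff]
      rw [hG1.convex.mem_convexHull_insert_zero_iff] at hx
      rcases hx with rfl | ⟨y, ⟨hyR, hym⟩, t, ht0, ht1, rfl⟩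
      · exact .inr (.inl rfl)
      obtain ⟨h1, h2, h3⟩ := (hmemP y).1 hyR.1
      have hyC := hCsmul y hyR.2
      have hjy := hj1 y hyR
      have hjy0 : 0 < j y := by linarith
      by_cases hjx : 1 ≤ j (t • y)
      · refine .inl ⟨(hmemP _).2 ⟨fun p hp hp0 => ?_, fun p hp hp0 => ?_, fun p hp hp0 =>
          hjx.trans (hmin p ⟨hp, hp0⟩ _ (hyC t ht0.le))⟩, hyC t ht0.le⟩
        · rw [map_smul, smul_eq_mul]; nlinarith [h1 p hp hp0]
        · rw [map_smul, smul_eq_mul]; nlinarith [h2 p hp hp0]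
      · right; right
        have hjx' : t * j y < 1 := by simpa using hjx
        refine ⟨(j y)⁻¹ • y, ⟨⟨(hmemP _).2 ?_, hyC _ (inv_pos.2 hjy0).le⟩, by simp [hjy0.ne']⟩,
          t * j y, by positivity, hjx'.le, ?_⟩
        · simp only [map_smul, smul_eq_mul, inv_mul_le_iff₀ hjy0, le_inv_mul_iff₀ hjy0, mul_one,
            mul_zero]
          exact ⟨fun p hp hp0 => (h1 p hp hp0).trans hjy, h2,
            fun p hp hp0 => hmin p ⟨hp, hp0⟩ y hyR.2⟩
        · rw [smul_smul, mul_assoc, mul_inv_cancel₀ hjy0.ne', mul_one]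
  have hinter : P ∩ C ∩ convexHull ℝ (insert 0 (P ∩ C ∩ {x | j x = 1})) =
      P ∩ C ∩ {x | j x = 1} := by
    apply Set.Subset.antisymm
    · rintro x ⟨hxR, hx⟩
      refine ⟨hxR, ?_⟩
      have hjx := hj1 x hxR
      rw [hG2.convex.mem_convexHull_insert_zero_iff] at hx
      rcases hx with rfl | ⟨y, ⟨hyR, hyj⟩, t, ht0, ht1, rfl⟩
      · simp at hjx; linarith
      · have hyj : j y = 1 := hyj
        rw [map_smul, smul_eq_mul, hyj, mul_one] at hjx
        obtain rfl : t = 1 := le_antisymm ht1 hjx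
        simpa using hyj
    · exact fun x hx => ⟨hx.1, subset_convexHull ℝ _ (.inr hx)⟩
  have := hZ.add hRpoly (hG2.join 0) (hunion ▸ hG1.join 0)
  rwa [hunion, hinter, hZA, hZB, hZG2, add_zero, add_zero] at this

end IsPolytopeValuation
end Valuations

/-! ### Reduction to simplices -/

section SimplexReduction

open scoped Pointwise

theorem AffineIndependent.insert_of_notMem_affineSpan {E : Type*} [AddCommGroup E] [Module ℝ E]
    {t : Set E} (ht : AffineIndependent ℝ ((↑) : t → E)) {v : E} (hv : v ∉ affineSpan ℝ t) :
    AffineIndependent ℝ ((↑) : ↥(insert v t : Set E) → E) := by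
  have hsub : ∀ y : ↥(insert v t), y ≠ ⟨v, Set.mem_insert v t⟩ → (y : E) ∈ t := by
    rintro ⟨y, rfl | hy⟩ hne
    exacts [(hne rfl).elim, hy]
  let e : {y : ↥(insert v t) // y ≠ ⟨v, Set.mem_insert v t⟩} ↪ t :=
    ⟨fun y => ⟨y.1, hsub y.1 y.2⟩, fun y z h =>
      Subtype.ext (Subtype.ext (congrArg (fun w : t => (w : E)) h))⟩
  refine AffineIndependent.affineIndependent_of_notMem_span (i := ⟨v, Set.mem_insert v t⟩)
    (ht.comp_embedding e) fun h => hv ?_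
  refine affineSpan_mono ℝ ?_ h
  rintro _ ⟨y, hy, rfl⟩
  exact hsub y hy

theorem AffineIndependent.linearIndependent_of_zero_notMem {E : Type*} [AddCommGroup E]
    [Module ℝ E] {t : Set E} (ht : AffineIndependent ℝ ((↑) : t → E))
    (h0 : (0 : E) ∉ affineSpan ℝ t) : LinearIndependent ℝ ((↑) : t → E) := by
  have h := (affineIndependent_set_iff_linearIndependent_vsub ℝ (Set.mem_insert 0 t)).1
    (ht.insert_of_notMem_affineSpan h0)
  have ht0 : (0 : E) ∉ t := fun h => h0 (subset_affineSpan ℝ t h)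
  have hset : (fun p : E => p -ᵥ (0 : E)) '' (insert 0 t \ {0}) = t := by
    simp [Set.insert_sdiff_of_mem, ht0]
  rwa [hset] at h

namespace IsPolytopeValuation

variable {E G : Type*} [NormedAddCommGroup E] [NormedSpace ℝ E] [FiniteDimensional ℝ E]
  [AddCommGroup G] {Z : Set E → G}

theorem eq_zero_of_pyramids_at (hZ : IsPolytopeValuation Z) {P : Set E}
    (hP : IsConvexPolytope P) (v : E)
    (h : ∀ G ⊆ P, IsConvexPolytope G → v ∉ affineSpan ℝ G →
      Z G = 0 ∧ Z (convexHull ℝ (insert v G)) = 0) : Z P = 0 := by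
  have h' := (hZ.translate v).eq_zero_of_pyramids (hP.vadd (-v)) fun G hGP hG h0 => by
    have := h (v +ᵥ G) (by simpa using Set.vadd_set_mono (a := v) hGP) (hG.vadd v) (by
      rw [← AffineSubspace.pointwise_vadd_span]
      rintro ⟨x, hx, hxv⟩
      obtain rfl : x = 0 := by simpa using hxv
      exact h0 hx)
    have hins : v +ᵥ (insert 0 G : Set E) = insert v (v +ᵥ G) := by
      rw [Set.vadd_set_insert]; simp
    rwa [← convexHull_vadd, hins]
  simpa using h'

theorem _root_.finrank_vectorSpan_lt_of_notMem {P G : Set E} {v : E} (hGP : G ⊆ P) (hv : v ∈ P)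
    (hvG : v ∉ affineSpan ℝ G) (hG : G.Nonempty) :
    Module.finrank ℝ (vectorSpan ℝ G) < Module.finrank ℝ (vectorSpan ℝ P) := by
  obtain ⟨g, hg⟩ := hG
  refine Submodule.finrank_lt_finrank_of_lt ((vectorSpan_mono ℝ hGP).lt_of_ne fun h => hvG ?_)
  have hmem : v -ᵥ g ∈ vectorSpan ℝ G := h ▸ vsub_mem_vectorSpan ℝ hv (hGP hg)
  have := vadd_mem_affineSpan_of_mem_affineSpan_of_mem_vectorSpan (subset_affineSpan ℝ G hg) hmem
  simpa using this

/-- A valuation that vanishes on the simplices contained in the affine hull of a polytope vanishes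
on the polytope. A point of the polytope serves as the apex of a dissection into pyramids, whose
bases have smaller dimension. -/
theorem eq_zero_of_simplices (hZ : IsPolytopeValuation Z) {P : Set E} (hP : IsConvexPolytope P)
    (h : ∀ t : Set E, t.Finite → AffineIndependent ℝ ((↑) : t → E) → t ⊆ affineSpan ℝ P →
      Z (convexHull ℝ t) = 0) : Z P = 0 := by
  induction hd : Module.finrank ℝ (vectorSpan ℝ P) using Nat.strong_induction_on
    generalizing P Z with
  | _ d ih =>
  rcases P.eq_empty_or_nonempty with rfl | ⟨v, hv⟩
  · exact hZ.empty
  have hvP := subset_affineSpan ℝ P hv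
  have hZv : Z {v} = 0 := by
    have := h {v} (Set.finite_singleton v) (affineIndependent_of_subsingleton ℝ _)
      (Set.singleton_subset_iff.2 hvP)
    rwa [convexHull_singleton] at this
  refine hZ.eq_zero_of_pyramids_at hP v fun G hGP hG hvG => ?_
  rcases G.eq_empty_or_nonempty with rfl | hne
  · exact ⟨hZ.empty, by simpa using hZv⟩
  have hlt : Module.finrank ℝ (vectorSpan ℝ G) < d :=
    hd ▸ finrank_vectorSpan_lt_of_notMem hGP hv hvG hne
  have hspan := affineSpan_mono ℝ hGP
  refine ⟨ih _ hlt hZ hG (fun t ht hi hs => h t ht hi (hs.trans hspan)) rfl, ?_⟩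
  have := ih _ hlt (hZ.join v) hG (fun t ht hi hs => ?_) rfl
  · simpa [hZv] using this
  · have hjoin : convexHull ℝ (insert v (convexHull ℝ t)) = convexHull ℝ (insert v t) := by
      rw [Set.insert_eq, convexHull_convexHull_union_right, ← Set.insert_eq]
    rw [hjoin, hZv, sub_zero]
    exact h _ (ht.insert v)
      (hi.insert_of_notMem_affineSpan fun hv' => hvG (affineSpan_le.2 hs hv'))
      (Set.insert_subset hvP (hs.trans hspan))

/-- A valuation on polytopes is determined by its values on the simplices `conv t` and
`conv (insert 0 t)` with `t` linearly independent: the bases of the pyramids with apex at the origin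
into which a polytope is dissected have an affine hull that misses the origin. -/
theorem eq_zero_of_linearIndependent (hZ : IsPolytopeValuation Z)
    (h : ∀ t : Set E, t.Finite → LinearIndependent ℝ ((↑) : t → E) →
      Z (convexHull ℝ t) = 0 ∧ Z (convexHull ℝ (insert 0 t)) = 0)
    {P : Set E} (hP : IsConvexPolytope P) : Z P = 0 := by
  have h0 : Z {0} = 0 := by
    simpa using (h ∅ Set.finite_empty (linearIndependent_empty ℝ E)).2
  refine hZ.eq_zero_of_pyramids hP fun G _ hG hG0 => ?_
  have hlin : ∀ t : Set E, AffineIndependent ℝ ((↑) : t → E) → t ⊆ affineSpan ℝ G →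
      LinearIndependent ℝ ((↑) : t → E) := fun t hi hs =>
    hi.linearIndependent_of_zero_notMem fun h => hG0 (affineSpan_le.2 hs h)
  refine ⟨hZ.eq_zero_of_simplices hG fun t ht hi hs => (h t ht (hlin t hi hs)).1, ?_⟩
  have := (hZ.join 0).eq_zero_of_simplices hG fun t ht hi hs => ?_
  · simpa [h0] using this
  · have hjoin : convexHull ℝ (insert 0 (convexHull ℝ t)) = convexHull ℝ (insert 0 t) := by
      rw [Set.insert_eq, convexHull_convexHull_union_right, ← Set.insert_eq]
    rw [hjoin, h0, sub_zero]
    exact (h t ht (hlin t hi hs)).2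

end IsPolytopeValuation

end SimplexReduction

/-! ### Faces of simplices and maps of determinant one -/

section Faces

variable {E : Type*} [AddCommGroup E] [Module ℝ E]

/-- The face of a convex hull cut out by a supporting hyperplane is the convex hull of the
generators that lie on the hyperplane. -/
theorem mem_convexHull_sep_of_eq {s : Set E} (g : E →ₗ[ℝ] ℝ) {c : ℝ} (hs : ∀ x ∈ s, g x ≤ c)
    {x : E} (hx : x ∈ convexHull ℝ s) (hgx : g x = c) :
    x ∈ convexHull ℝ {y ∈ s | g y = c} := by
  have hsub : convexHull ℝ s ⊆ {x | g x ≤ c ∧ (g x = c → x ∈ convexHull ℝ {y ∈ s | g y = c})} := by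
    refine convexHull_min (fun x hx => ⟨hs x hx, fun h => subset_convexHull ℝ _ ⟨hx, h⟩⟩) ?_
    rw [convex_iff_forall_pos]
    rintro x ⟨hx, hx'⟩ y ⟨hy, hy'⟩ a b ha hb hab
    obtain rfl : b = 1 - a := by linarith
    simp only [Set.mem_ofPred_eq, map_add, map_smul, smul_eq_mul]
    refine ⟨by nlinarith, fun h => ?_⟩
    have h1 : g x = c := by nlinarith
    have h2 : g y = c := by nlinarith
    exact convex_convexHull ℝ _ (hx' h1) (hy' h2) ha.le hb.le hab
  exact (hsub hx).2 hgx

theorem convexHull_insert_union_of_mem_openSegment {r : Set E} (hr : r.Nonempty) {a b p : E}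
    (hp : p ∈ openSegment ℝ a b) :
    convexHull ℝ (insert a (insert p r)) ∪ convexHull ℝ (insert b (insert p r)) =
      convexHull ℝ (insert a (insert b r)) := by
  have hpab : p ∈ convexHull ℝ (insert a (insert b r)) :=
    (convex_convexHull ℝ _).openSegment_subset (subset_convexHull ℝ _ (by simp))
      (subset_convexHull ℝ _ (by simp)) hp
  have hsub := subset_convexHull ℝ (insert a (insert b r))
  apply Set.Subset.antisymm
  · refine Set.union_subset (convexHull_min ?_ (convex_convexHull ℝ _))
      (convexHull_min ?_ (convex_convexHull ℝ _))
    · exact Set.insert_subset (hsub (by simp)) (Set.insert_subset hpab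
        fun x hx => hsub (by simp [hx]))
    · exact Set.insert_subset (hsub (by simp)) (Set.insert_subset hpab
        fun x hx => hsub (by simp [hx]))
  · intro x hx
    have hset : insert a (insert b r) = {a, b} ∪ r := by
      rw [Set.insert_union, Set.singleton_union]
    rw [hset, convexHull_union (by simp) hr, convexHull_pair, mem_convexJoin] at hx
    obtain ⟨y, hy, q, hq, hx⟩ := hx
    have hcov : y ∈ segment ℝ a p ∪ segment ℝ b p := by
      rw [segment_symm ℝ b p]
      rw [← insert_endpoints_openSegment] at hy
      have hline : p ∈ Set.range (AffineMap.lineMap a b : ℝ → E) := by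
        rw [openSegment_eq_image_lineMap] at hp
        obtain ⟨t, -, rfl⟩ := hp
        exact ⟨t, rfl⟩
      rcases hy with rfl | rfl | hy
      · exact .inl (left_mem_segment ℝ _ _)
      · exact .inr (right_mem_segment ℝ _ _)
      rcases openSegment_subset_union a b hline hy with rfl | hy | hy
      · exact .inl (right_mem_segment ℝ _ _)
      · exact .inl (openSegment_subset_segment ℝ _ _ hy)
      · exact .inr (openSegment_subset_segment ℝ _ _ hy)
    have aux : ∀ e, y ∈ segment ℝ e p → x ∈ convexHull ℝ (insert e (insert p r)) := by
      intro e he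
      have h1 : segment ℝ e p ⊆ convexHull ℝ (insert e (insert p r)) :=
        (convex_convexHull ℝ _).segment_subset (subset_convexHull ℝ _ (by simp))
          (subset_convexHull ℝ _ (by simp))
      exact (convex_convexHull ℝ _).segment_subset (h1 he)
        (convexHull_mono (fun z hz => by simp [hz]) hq) hx
    exact hcov.imp (aux a) (aux b)

theorem convexHull_insert_inter_of_separated {r : Set E} {a b p : E} (g : E →ₗ[ℝ] ℝ)
    (hr : ∀ x ∈ insert p r, g x = 0) (ha : g a < 0) (hb : 0 < g b) :
    convexHull ℝ (insert a (insert p r)) ∩ convexHull ℝ (insert b (insert p r)) =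
      convexHull ℝ (insert p r) := by
  apply Set.Subset.antisymm
  · rintro x ⟨hxa, hxb⟩
    have h1 : ∀ y ∈ insert a (insert p r), g y ≤ 0 := by
      rintro y (rfl | hy)
      exacts [ha.le, (hr y hy).le]
    have h2 : ∀ y ∈ insert b (insert p r), 0 ≤ g y := by
      rintro y (rfl | hy)
      exacts [hb.le, (hr y hy).ge]
    have h3 : g x ≤ 0 := convexHull_min h1 (convex_halfSpace_le g.isLinear 0) hxa
    have h4 : 0 ≤ g x := convexHull_min h2 (convex_halfSpace_ge g.isLinear 0) hxb
    refine convexHull_mono ?_ (mem_convexHull_sep_of_eq g h1 hxa (le_antisymm h3 h4))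
    rintro y ⟨rfl | hy, hy0⟩
    exacts [(ha.ne hy0).elim, hy]
  · exact Set.subset_inter (convexHull_mono (Set.subset_insert _ _))
      (convexHull_mono (Set.subset_insert _ _))

end Faces

section UnimodularMaps

variable {E : Type*} [AddCommGroup E] [Module ℝ E]

theorem LinearIndependent.exists_dual {t : Set E} (ht : LinearIndependent ℝ ((↑) : t → E))
    (a : E → ℝ) : ∃ f : E →ₗ[ℝ] ℝ, ∀ x ∈ t, f x = a x := by
  obtain ⟨L, hL⟩ := LinearMap.exists_leftInverse_of_injective _ (LinearMap.ker_eq_bot.2 ht)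
  refine ⟨Finsupp.linearCombination ℝ (fun x : t => a x) ∘ₗ L, fun x hx => ?_⟩
  have h := LinearMap.congr_fun hL (Finsupp.single (⟨x, hx⟩ : t) 1)
  simp only [LinearMap.comp_apply, Finsupp.linearCombination_single, one_smul,
    LinearMap.id_apply] at h
  simp [h]

/-- The exchange of two members of an independent set has determinant `-1`: it is the transvection
(in fact a reflection) along their difference. -/
theorem LinearIndependent.exists_swap [FiniteDimensional ℝ E] {t : Set E}
    (ht : LinearIndependent ℝ ((↑) : t → E)) {a b : E} (ha : a ∈ t) (hb : b ∈ t) (hab : a ≠ b) :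
    ∃ φ : E →ₗ[ℝ] E, LinearMap.det φ = -1 ∧ φ a = b ∧ φ b = a ∧
      ∀ x ∈ t, x ≠ a → x ≠ b → φ x = x := by
  classical
  obtain ⟨f, hf⟩ := ht.exists_dual fun x => if x = a then 1 else if x = b then -1 else 0
  have hfa : f a = 1 := by simp [hf a ha]
  have hfb : f b = -1 := by simp [hf b hb, hab.symm]
  refine ⟨LinearMap.transvection f (b - a), ?_, ?_, ?_, fun x hx hxa hxb => ?_⟩
  · rw [LinearMap.transvection.det, map_sub, hfa, hfb]; norm_num
  · rw [LinearMap.transvection.apply, hfa]; simp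
  · rw [LinearMap.transvection.apply, hfb]; simp
  · rw [LinearMap.transvection.apply, hf x hx]; simp [hxa, hxb]

theorem LinearIndependent.exists_negation [FiniteDimensional ℝ E] {t : Set E}
    (ht : LinearIndependent ℝ ((↑) : t → E)) {a : E} (ha : a ∈ t) :
    ∃ φ : E →ₗ[ℝ] E, LinearMap.det φ = -1 ∧ φ a = -a ∧ ∀ x ∈ t, x ≠ a → φ x = x := by
  classical
  obtain ⟨f, hf⟩ := ht.exists_dual fun x => if x = a then 1 else 0
  have hfa : f a = 1 := by simp [hf a ha]
  refine ⟨LinearMap.transvection f ((-2 : ℝ) • a), ?_, ?_, fun x hx hxa => ?_⟩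
  · rw [LinearMap.transvection.det, map_smul, hfa]; norm_num
  · rw [LinearMap.transvection.apply, hfa]; module
  · rw [LinearMap.transvection.apply, hf x hx]; simp [hxa]

theorem image_swap_eq {α : Type*} {t : Set α} {a b : α} (ha : a ∈ t) (hb : b ∈ t) {φ : α → α}
    (h1 : φ a = b) (h2 : φ b = a) (h3 : ∀ x ∈ t, x ≠ a → x ≠ b → φ x = x) : φ '' t = t := by
  apply Set.Subset.antisymm
  · rintro _ ⟨x, hx, rfl⟩
    by_cases hxa : x = a
    · rw [hxa, h1]; exact hb
    by_cases hxb : x = b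
    · rw [hxb, h2]; exact ha
    rwa [h3 x hx hxa hxb]
  · intro x hx
    by_cases hxa : x = a
    · exact ⟨b, hb, h2.trans hxa.symm⟩
    by_cases hxb : x = b
    · exact ⟨a, ha, h1.trans hxb.symm⟩
    exact ⟨x, hx, h3 x hx hxa hxb⟩

theorem image_eq_of_subset_zero {c : Set E} (hc : c ⊆ {0}) (φ : E →ₗ[ℝ] E) : φ '' c = c := by
  rcases Set.subset_singleton_iff_eq.1 hc with rfl | rfl <;> simp

theorem image_convexHull_union {c t : Set E} (hc : c ⊆ {0}) (φ : E →ₗ[ℝ] E) :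
    φ '' convexHull ℝ (c ∪ t) = convexHull ℝ (c ∪ φ '' t) := by
  rw [LinearMap.image_convexHull, Set.image_union, image_eq_of_subset_zero hc]

end UnimodularMaps

/-! ### Contravariant valuations on simplices -/

section SLCovariance

variable {E : Type*} [NormedAddCommGroup E] [NormedSpace ℝ E]

/-- Contravariance of a vector-valued function under the maps of determinant one, expressed through
the linear functionals that the values represent. -/
def IsUnimodularContravariant (Z : Set E → E →ₗ[ℝ] ℝ) : Prop :=
  ∀ φ : E →ₗ[ℝ] E, LinearMap.det φ = 1 → ∀ P : Set E, IsConvexPolytope P →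
    ∀ x, Z (φ '' P) (φ x) = Z P x


theorem isConvexPolytope_convexHull_union {c t : Set E} (hc : c ⊆ {0}) (ht : t.Finite) :
    IsConvexPolytope (convexHull ℝ (c ∪ t)) :=
  ⟨_, ((Set.finite_singleton 0).subset hc).union ht, rfl⟩

variable {Z : Set E → E →ₗ[ℝ] ℝ}

theorem IsUnimodularContravariant.apply_eq_of_image_eq (hZ : IsUnimodularContravariant Z)
    {c t : Set E} (hc : c ⊆ {0}) (ht : t.Finite) {φ : E →ₗ[ℝ] E} (hφ : LinearMap.det φ = 1)
    (hφt : φ '' t = t) (x : E) :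
    Z (convexHull ℝ (c ∪ t)) (φ x) = Z (convexHull ℝ (c ∪ t)) x := by
  have := hZ φ hφ _ (isConvexPolytope_convexHull_union hc ht) x
  rwa [image_convexHull_union hc, hφt] at this

/-- The value at a simplex that spans less than the whole space is zero. Transvections along the
span dispose of every vector that together with `t` does not span. What is left is the normal
direction of a hyperplane spanned by `t`, which is reversed by a map of determinant one that also
exchanges two vertices. -/
theorem IsUnimodularContravariant.eq_zero_of_ncard_lt [FiniteDimensional ℝ E]
    (hZ : IsUnimodularContravariant Z)
    (hn : 3 ≤ Module.finrank ℝ E) {c t : Set E} (hc : c ⊆ {0}) (ht : t.Finite)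
    (hli : LinearIndependent ℝ ((↑) : t → E)) (hcard : t.ncard < Module.finrank ℝ E) :
    Z (convexHull ℝ (c ∪ t)) = 0 := by
  ext w
  rw [LinearMap.zero_apply]
  have hfin : ∀ s : Set E, s.Finite → LinearIndependent ℝ ((↑) : s → E) →
      Module.finrank ℝ (Submodule.span ℝ s) = s.ncard := fun s hs hsl => by
    have := hs.fintype
    rw [finrank_span_set_eq_card hsl, Set.ncard_eq_toFinset_card']
  by_cases hspan : Submodule.span ℝ (insert w t) = ⊤
  · have hwt : w ∉ Submodule.span ℝ t := by
      intro hw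
      rw [Submodule.span_insert_eq_span hw] at hspan
      have := hfin t ht hli
      rw [hspan, finrank_top] at this
      omega
    have hwt' : w ∉ t := fun h => hwt (Submodule.subset_span h)
    have hli' : LinearIndependent ℝ ((↑) : ↥(insert w t) → E) :=
      (LinearIndepOn.id_insert hli hwt : LinearIndepOn ℝ id (insert w t))
    have hcard' : t.ncard + 1 = Module.finrank ℝ E := by
      rw [← Set.ncard_insert_of_notMem hwt' ht, ← hfin _ (ht.insert w) hli', hspan, finrank_top]
    obtain ⟨a, ha, b, hb, hab⟩ := (Set.one_lt_ncard ht).1 (by omega : 1 < t.ncard)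
    obtain ⟨φ, hφ, hφa, hφb, hφx⟩ := hli'.exists_swap (.inr ha) (.inr hb) hab
    obtain ⟨ψ, hψ, hψw, hψx⟩ := hli'.exists_negation (Set.mem_insert w t)
    have hne : ∀ x ∈ t, x ≠ w := fun x hx h => hwt' (h ▸ hx)
    have key := hZ.apply_eq_of_image_eq hc ht (φ := ψ ∘ₗ φ)
      (by rw [LinearMap.det_comp, hφ, hψ]; norm_num) (image_swap_eq ha hb
        (by simp [hφa, hψx b (.inr hb) (hne b hb)]) (by simp [hφb, hψx a (.inr ha) (hne a ha)])
        fun x hx hxa hxb => by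
          simp [hφx x (.inr hx) hxa hxb, hψx x (.inr hx) (hne x hx)]) w
    rw [LinearMap.comp_apply, hφx w (.inl rfl) (hne a ha).symm (hne b hb).symm, hψw,
      map_neg] at key
    linarith
  · obtain ⟨g, hg0, hg⟩ := Submodule.exists_le_ker_of_lt_top _ (lt_top_iff_ne_top.2 hspan)
    have hgm : ∀ x ∈ insert w t, g x = 0 := fun x hx => hg (Submodule.subset_span hx)
    obtain ⟨x, hx⟩ : ∃ x, g x ≠ 0 := by
      by_contra! h
      exact hg0 (LinearMap.ext h)
    have hgw := hgm w (.inl rfl)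
    have key := hZ.apply_eq_of_image_eq hc ht (φ := LinearMap.transvection g w)
      (by rw [LinearMap.transvection.det, hgw, add_zero]) (by
        have : Set.EqOn (LinearMap.transvection g w) id t := fun y hy => by
          rw [LinearMap.transvection.apply, hgm y (.inr hy)]; simp
        rw [this.image_eq, Set.image_id]) x
    rw [LinearMap.transvection.apply, map_add, map_smul, smul_eq_mul] at key
    exact (mul_eq_zero.1 (by linarith)).resolve_left hx

/-- All vertices of a full-dimensional simplex take the same value, because the alternating group
acts transitively on them. -/
theorem IsUnimodularContravariant.apply_eq_apply [FiniteDimensional ℝ E]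
    (hZ : IsUnimodularContravariant Z)
    {c t : Set E} (hc : c ⊆ {0}) (ht : t.Finite) (hli : LinearIndependent ℝ ((↑) : t → E))
    (hcard : 3 ≤ t.ncard) {a b : E} (ha : a ∈ t) (hb : b ∈ t) :
    Z (convexHull ℝ (c ∪ t)) a = Z (convexHull ℝ (c ∪ t)) b := by
  by_cases hab : a = b
  · rw [hab]
  obtain ⟨d, hd, hdab⟩ := Set.exists_mem_notMem_of_ncard_lt_ncard (s := {a, b}) (t := t)
    (by rw [Set.ncard_pair hab]; omega)
  have hda : d ≠ a := fun h => hdab (by simp [h])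
  have hdb : d ≠ b := fun h => hdab (by simp [h])
  obtain ⟨φ, hφ, hφa, hφd, hφx⟩ := hli.exists_swap ha hd hda.symm
  obtain ⟨ψ, hψ, hψd, hψb, hψx⟩ := hli.exists_swap hd hb hdb
  have key := hZ.apply_eq_of_image_eq hc ht (φ := ψ ∘ₗ φ)
    (by rw [LinearMap.det_comp, hφ, hψ]; norm_num) (by
      rw [LinearMap.coe_comp, Set.image_comp, image_swap_eq ha hd hφa hφd hφx,
        image_swap_eq hd hb hψd hψb hψx]) a
  rw [LinearMap.comp_apply, hφa, hψd] at key
  exact key.symm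

section Families

variable {m : ℕ} (b : Module.Basis (Fin (m + 3)) ℝ E)

theorem linearIndependent_of_det_ne_zero {v : Fin (m + 3) → E} (hv : b.det v ≠ 0) :
    LinearIndependent ℝ v :=
  ((Module.Basis.is_basis_iff_det b).2 (isUnit_iff_ne_zero.2 hv)).1

theorem IsUnimodularContravariant.apply_eq_of_det_eq (hZ : IsUnimodularContravariant Z)
    {c : Set E} (hc : c ⊆ {0}) {v v' : Fin (m + 3) → E} (hv : b.det v ≠ 0)
    (h : b.det v = b.det v') (i : Fin (m + 3)) :
    Z (convexHull ℝ (c ∪ Set.range v)) (v i) = Z (convexHull ℝ (c ∪ Set.range v')) (v' i) := by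
  have hb := (Module.Basis.is_basis_iff_det b).2 (isUnit_iff_ne_zero.2 hv)
  let bv : Module.Basis (Fin (m + 3)) ℝ E := Module.Basis.mk hb.1 hb.2.ge
  let φ : E →ₗ[ℝ] E := bv.constr ℝ v'
  have hφ : ∀ i, φ (v i) = v' i := fun i => by
    have := bv.constr_basis ℝ v' i
    rwa [Module.Basis.mk_apply] at this
  have hφv : φ ∘ v = v' := funext hφ
  have hdet : LinearMap.det φ = 1 := by
    have := b.det_comp φ v
    rw [hφv, ← h] at this
    exact (mul_right_cancel₀ hv (by rw [one_mul]; exact this)).symm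
  have := hZ φ hdet _ (isConvexPolytope_convexHull_union hc (Set.finite_range v)) (v i)
  rw [image_convexHull_union hc, ← Set.range_comp, hφv, hφ] at this
  exact this.symm

theorem IsUnimodularContravariant.apply_eq_of_abs_det_eq [FiniteDimensional ℝ E]
    (hZ : IsUnimodularContravariant Z)
    {c : Set E} (hc : c ⊆ {0}) {v v' : Fin (m + 3) → E} (hv : b.det v ≠ 0)
    (h : |b.det v| = |b.det v'|) (i j : Fin (m + 3)) :
    Z (convexHull ℝ (c ∪ Set.range v)) (v i) = Z (convexHull ℝ (c ∪ Set.range v')) (v' j) := by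
  have hv' : b.det v' ≠ 0 := abs_ne_zero.1 (h ▸ abs_ne_zero.2 hv)
  have hli := linearIndependent_of_det_ne_zero b hv'
  have hany : ∀ i j, Z (convexHull ℝ (c ∪ Set.range v')) (v' i) =
      Z (convexHull ℝ (c ∪ Set.range v')) (v' j) := fun i j =>
    hZ.apply_eq_apply hc (Set.finite_range v') hli.linearIndepOn_id (by
      rw [Set.ncard_range_of_injective hli.injective]; simp) ⟨i, rfl⟩ ⟨j, rfl⟩
  -- Exchanging two vertices adjusts the sign of the determinant and keeps the simplex.
  rcases abs_eq_abs.1 h with h | h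
  · rw [hZ.apply_eq_of_det_eq b hc hv h i, hany i j]
  · have h01 : (0 : Fin (m + 3)) ≠ 1 := by simp
    have hswap : b.det v = b.det (v' ∘ Equiv.swap 0 1) := by
      rw [AlternatingMap.map_swap _ _ h01, h]
    rw [hZ.apply_eq_of_det_eq b hc hv hswap i, EquivLike.range_comp, Function.comp_apply,
      hany _ j]

theorem det_update_smul_self (d : ℝ) : b.det (Function.update b 0 (d • b 0)) = d := by
  rw [AlternatingMap.map_update_smul, Function.update_eq_self, b.det_self, smul_eq_mul, mul_one]

/-- The value of `Z` at the vertices of a simplex `conv (c ∪ {v₀, …})`, as a function of the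
absolute value of the determinant of `v`. The representative `v` is the basis `b` with `b 0` scaled,
and the vertex is `b 1`, which is not affected by the scaling. -/
noncomputable def simplexValue (Z : Set E → E →ₗ[ℝ] ℝ) (c : Set E) (d : ℝ) : ℝ :=
  Z (convexHull ℝ (c ∪ Set.range (Function.update b 0 (d • b 0)))) (b 1)

theorem IsUnimodularContravariant.apply_eq_simplexValue [FiniteDimensional ℝ E]
    (hZ : IsUnimodularContravariant Z)
    {c : Set E} (hc : c ⊆ {0}) {v : Fin (m + 3) → E} (hv : b.det v ≠ 0) (i : Fin (m + 3)) :
    Z (convexHull ℝ (c ∪ Set.range v)) (v i) = simplexValue b Z c |b.det v| := by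
  have := hZ.apply_eq_of_abs_det_eq b hc hv
    (v' := Function.update b 0 (|b.det v| • b 0)) (by rw [det_update_smul_self, abs_abs]) i 1
  rw [this, simplexValue]
  simp

/-- Cutting a simplex through a point of an edge shows that the value at the vertices is additive in
the determinant. The common face of the two parts is not full-dimensional and contributes
nothing. -/
theorem IsUnimodularContravariant.simplexValue_add [FiniteDimensional ℝ E]
    (hZ : IsUnimodularContravariant Z)
    (hval : IsPolytopeValuation Z) {c : Set E} (hc : c ⊆ {0}) {x y : ℝ} (hx : 0 < x)
    (hy : 0 < y) : simplexValue b Z c (x + y) = simplexValue b Z c x + simplexValue b Z c y := by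
  have hxy : 0 < x + y := add_pos hx hy
  set v : Fin (m + 3) → E := Function.update b 0 ((x + y) • b 0) with hvdef
  have hdet : b.det v = x + y := det_update_smul_self b _
  have hli := linearIndependent_of_det_ne_zero b (hdet ▸ hxy.ne')
  -- The weights are chosen so that replacing `v 0` or `v 1` by `p` gives determinant `x` or `y`.
  set p : E := (x / (x + y)) • v 0 + (y / (x + y)) • v 1 with hp
  have hpo : p ∈ openSegment ℝ (v 0) (v 1) :=
    ⟨x / (x + y), y / (x + y), by positivity, by positivity, by field_simp, rfl⟩
  have h01 : (0 : Fin (m + 3)) ≠ 1 := by simp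
  have h2 : 2 % (m + 3) = 2 := Nat.mod_eq_of_lt (by omega)
  have h20 : (2 : Fin (m + 3)) ≠ 0 := by simp [Fin.ext_iff, h2]
  have h21 : (2 : Fin (m + 3)) ≠ 1 := by simp [Fin.ext_iff, h2]
  set v₀ := Function.update v 0 p with hv0
  set v₁ := Function.update v 1 p with hv1
  have hd0 : b.det v₀ = x := by
    rw [hv0, hp, AlternatingMap.map_update_add, AlternatingMap.map_update_smul,
      AlternatingMap.map_update_smul, Function.update_eq_self,
      AlternatingMap.map_update_self _ _ h01, hdet]
    simp; field_simp
  have hd1 : b.det v₁ = y := by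
    rw [hv1, hp, AlternatingMap.map_update_add, AlternatingMap.map_update_smul,
      AlternatingMap.map_update_smul, Function.update_eq_self,
      AlternatingMap.map_update_self _ _ h01.symm, hdet]
    simp; field_simp
  let r : Set E := c ∪ v '' {i | i ≠ 0 ∧ i ≠ 1}
  have hrange : ∀ w : Fin (m + 3) → E, (∀ i, i ≠ 0 → i ≠ 1 → w i = v i) →
      c ∪ Set.range w = insert (w 0) (insert (w 1) r) := by
    intro w hw
    have : Set.range w = insert (w 0) (insert (w 1) (v '' {i | i ≠ 0 ∧ i ≠ 1})) := by
      ext z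
      simp only [Set.mem_range, Set.mem_insert_iff, Set.mem_image, Set.mem_ofPred_eq]
      constructor
      · rintro ⟨i, rfl⟩
        by_cases hi0 : i = 0
        · exact .inl (by rw [hi0])
        by_cases hi1 : i = 1
        · exact .inr (.inl (by rw [hi1]))
        exact .inr (.inr ⟨i, ⟨hi0, hi1⟩, (hw i hi0 hi1).symm⟩)
      · rintro (rfl | rfl | ⟨i, ⟨h0, h1⟩, rfl⟩)
        exacts [⟨0, rfl⟩, ⟨1, rfl⟩, ⟨i, hw i h0 h1⟩]
    rw [this, Set.union_insert, Set.union_insert]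
  have hr : c ∪ Set.range v = insert (v 0) (insert (v 1) r) := hrange v fun _ _ _ => rfl
  have hr0 : c ∪ Set.range v₀ = insert (v 1) (insert p r) := by
    rw [hrange v₀ fun i hi _ => by simp [hv0, hi], Set.insert_comm]
    simp [hv0]
  have hr1 : c ∪ Set.range v₁ = insert (v 0) (insert p r) := by
    rw [hrange v₁ fun i _ hi => by simp [hv1, hi]]
    simp [hv1]
  have hunion := convexHull_insert_union_of_mem_openSegment (r := r)
    ⟨v 2, .inr ⟨2, ⟨h20, h21⟩, rfl⟩⟩ hpo
  classical
  obtain ⟨g, hg⟩ := hli.linearIndepOn_id.exists_dual (fun z => if z = v 0 then -y else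
    if z = v 1 then x else 0)
  have hg0 : g (v 0) = -y := by simp [hg (v 0) ⟨0, rfl⟩]
  have hg1 : g (v 1) = x := by simp [hg (v 1) ⟨1, rfl⟩, hli.injective.ne h01.symm]
  have hgr : ∀ z ∈ insert p r, g z = 0 := by
    rintro z (rfl | hz | ⟨i, ⟨h0, h1⟩, rfl⟩)
    · rw [hp, map_add, map_smul, map_smul, hg0, hg1]; simp; field_simp; ring
    · rw [show z = 0 from hc hz, map_zero]
    · simp [hg (v i) ⟨i, rfl⟩, hli.injective.ne h0, hli.injective.ne h1]
  have hinter := convexHull_insert_inter_of_separated (r := r) g hgr (a := v 0) (b := v 1)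
    (by rw [hg0]; linarith) (by rw [hg1]; exact hx)
  have hface : Z (convexHull ℝ (insert p r)) = 0 := by
    have hset : insert p r = c ∪ v₀ '' {i | i ≠ 1} := by
      have : v₀ '' {i | i ≠ 1} = insert p (v '' {i | i ≠ 0 ∧ i ≠ 1}) := by
        ext z
        simp only [Set.mem_insert_iff, Set.mem_image, Set.mem_ofPred_eq]
        constructor
        · rintro ⟨i, hi, rfl⟩
          by_cases hi0 : i = 0
          · left; simp [hi0, hv0]
          · right; exact ⟨i, ⟨hi0, hi⟩, by simp [hv0, hi0]⟩
        · rintro (rfl | ⟨i, ⟨h0, h1⟩, rfl⟩)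
          · exact ⟨0, h01, by simp [hv0]⟩
          · exact ⟨i, h1, by simp [hv0, h0]⟩
      rw [this, Set.union_insert]
    have hli0 := linearIndependent_of_det_ne_zero b (v := v₀) (hd0 ▸ hx.ne')
    have hrank : Module.finrank ℝ E = m + 3 := by
      rw [Module.finrank_eq_card_basis b, Fintype.card_fin]
    rw [hset]
    refine hZ.eq_zero_of_ncard_lt (by omega) hc (Set.toFinite _)
      (hli0.linearIndepOn_id.mono (Set.image_subset_range _ _)) ?_
    have hlt : (v₀ '' {i | i ≠ 1}).ncard < (Set.range v₀).ncard := by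
      refine Set.ncard_lt_ncard ⟨Set.image_subset_range _ _, fun h => ?_⟩ (Set.finite_range _)
      obtain ⟨i, hi, hi'⟩ := h ⟨1, rfl⟩
      exact hi (hli0.injective hi')
    rw [Set.ncard_range_of_injective hli0.injective] at hlt
    rw [hrank]
    simpa using hlt
  have hadd := hval.add
    (P := convexHull ℝ (insert (v 0) (insert p r))) (Q := convexHull ℝ (insert (v 1) (insert p r)))
    (hr1 ▸ isConvexPolytope_convexHull_union hc (Set.finite_range v₁))
    (hr0 ▸ isConvexPolytope_convexHull_union hc (Set.finite_range v₀))
    (hunion ▸ hr ▸ isConvexPolytope_convexHull_union hc (Set.finite_range v))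
  rw [hunion, hinter, hface, add_zero, ← hr, ← hr0, ← hr1] at hadd
  -- The vertex `v 2` belongs to the whole simplex and to both parts.
  have h := LinearMap.congr_fun hadd (v 2)
  rw [LinearMap.add_apply] at h
  have e := hZ.apply_eq_simplexValue b hc (v := v) (hdet ▸ hxy.ne') 2
  have e0 := hZ.apply_eq_simplexValue b hc (v := v₀) (hd0 ▸ hx.ne') 2
  have e1 := hZ.apply_eq_simplexValue b hc (v := v₁) (hd1 ▸ hy.ne') 2
  rw [hdet, abs_of_pos hxy] at e
  rw [hd0, abs_of_pos hx, hv0, Function.update_of_ne h20, ← hv0] at e0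
  rw [hd1, abs_of_pos hy, hv1, Function.update_of_ne h21, ← hv1] at e1
  rw [e, e0, e1] at h
  rw [← h, add_comm]

end Families

end SLCovariance

/-! ### The facet vector as a contravariant valuation -/

namespace PolytopeIn

section Faces

variable {n : ℕ}

theorem isConvexPolytope (P : PolytopeIn n) : IsConvexPolytope P.carrier := by
  obtain ⟨s, hs, -, h⟩ := P.2
  exact ⟨s, hs, h⟩

theorem carrier_nonempty (P : PolytopeIn n) : P.carrier.Nonempty := by
  obtain ⟨s, -, hne, h⟩ := P.2
  change (P.1).Nonempty
  exact h ▸ hne.convexHull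

theorem ext_carrier {P Q : PolytopeIn n} (h : P.carrier = Q.carrier) : P = Q := Subtype.ext h

/-- The linear functional `x ↦ ⟨x, u⟩`. -/
noncomputable def innerLeft (u : EuclideanSpace ℝ (Fin n)) : EuclideanSpace ℝ (Fin n) →ₗ[ℝ] ℝ :=
  (innerₛₗ ℝ) u

theorem innerLeft_apply (u x : EuclideanSpace ℝ (Fin n)) : innerLeft u x = inner ℝ x u := by
  rw [innerLeft, innerₛₗ_apply_apply, real_inner_comm]

theorem inner_le_supportFun (P : PolytopeIn n) (u : EuclideanSpace ℝ (Fin n))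
    {x : EuclideanSpace ℝ (Fin n)} (hx : x ∈ P.carrier) : inner ℝ x u ≤ P.supportFun u :=
  le_csSup (P.isConvexPolytope.isCompact.image (by fun_prop)).bddAbove
    (Set.mem_image_of_mem _ hx)

theorem face_nonempty (P : PolytopeIn n) (u : EuclideanSpace ℝ (Fin n)) : (P.face u).Nonempty := by
  obtain ⟨x, hx, h⟩ := P.isConvexPolytope.isCompact.exists_sSup_image_eq P.carrier_nonempty
    (f := fun x => inner ℝ x u) (by fun_prop)
  exact ⟨x, hx, h.symm⟩

theorem supportFun_eq_of_forall_le (P : PolytopeIn n) {u x : EuclideanSpace ℝ (Fin n)}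
    (hx : x ∈ P.carrier) (h : ∀ y ∈ P.carrier, inner ℝ y u ≤ inner ℝ x u) :
    P.supportFun u = inner ℝ x u := by
  obtain ⟨y, hy, hyu⟩ := P.face_nonempty u
  exact le_antisymm (hyu ▸ h y hy) (P.inner_le_supportFun u hx)

theorem face_eq_inter (P : PolytopeIn n) (u : EuclideanSpace ℝ (Fin n)) :
    P.face u = P.carrier ∩ {x | innerLeft u x = P.supportFun u} := by
  ext x; simp only [face, Set.mem_inter_iff, Set.mem_ofPred_eq, innerLeft_apply]

theorem isConvexPolytope_face (P : PolytopeIn n) (u : EuclideanSpace ℝ (Fin n)) :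
    IsConvexPolytope (P.face u) := by
  rw [face_eq_inter]
  exact P.isConvexPolytope.inter_isPolyhedron (isPolyhedron_eq _ _)

theorem vectorSpan_face_le (P : PolytopeIn n) (u : EuclideanSpace ℝ (Fin n)) :
    vectorSpan ℝ (P.face u) ≤ (ℝ ∙ u)ᗮ := by
  refine Submodule.span_le.2 ?_
  rintro _ ⟨a, ha, b, hb, rfl⟩
  rw [SetLike.mem_coe, Submodule.mem_orthogonal_singleton_iff_inner_left]
  change inner ℝ (a - b) u = 0
  rw [inner_sub_left, ha.2, hb.2, sub_self]

theorem volume_cone_lt_top (P : PolytopeIn n) (u : EuclideanSpace ℝ (Fin n)) :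
    MeasureTheory.volume (convexHull ℝ (insert 0 (P.face u))) < ⊤ :=
  ((P.isConvexPolytope_face u).join 0).isCompact.measure_lt_top

/-- The cone over a face that does not contribute to the facet vector is degenerate. Hence the
facet vector may be written as a sum over all unit vectors. -/
theorem coneVolume_eq_zero (P : PolytopeIn n) {u : EuclideanSpace ℝ (Fin n)} (hu : ‖u‖ = 1)
    (h : u ∉ P.facetNormals \ P.facetNormalsOrigin) : P.coneVolume u = 0 := by
  by_contra hV
  have hvol : MeasureTheory.volume (convexHull ℝ (insert 0 (P.face u))) ≠ 0 := fun h0 =>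
    hV (by rw [coneVolume, h0, ENNReal.toNNReal_zero])
  have htop : affineSpan ℝ (insert 0 (P.face u)) = ⊤ := by
    by_contra hne
    refine hvol (MeasureTheory.measure_mono_null (convexHull_subset_affineSpan _) ?_)
    exact MeasureTheory.Measure.addHaar_affineSubspace _ _ hne
  have hn : Module.finrank ℝ (vectorSpan ℝ (insert 0 (P.face u))) = n := by
    rw [← direction_affineSpan, htop, AffineSubspace.direction_top, finrank_top,
      finrank_euclideanSpace_fin]
  have hle := finrank_vectorSpan_insert_le_set ℝ (P.face u) (0 : EuclideanSpace ℝ (Fin n))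
  have hu0 : u ≠ 0 := fun h => by simp [h] at hu
  have horth : Module.finrank ℝ (ℝ ∙ u)ᗮ + 1 = n := by
    have := Submodule.finrank_add_finrank_orthogonal (ℝ ∙ u)
    rw [finrank_span_singleton hu0, finrank_euclideanSpace_fin] at this
    omega
  have hlt := Submodule.finrank_mono (P.vectorSpan_face_le u)
  refine h ⟨⟨hu, by omega⟩, fun h0 => ?_⟩
  rw [affineSpan_insert_eq_affineSpan ℝ h0.2] at htop
  rw [← direction_affineSpan, htop, AffineSubspace.direction_top, finrank_top,
      finrank_euclideanSpace_fin] at hlt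
  omega

end Faces

section FacetVector

variable {n : ℕ} {ζ : ℝ≥0 → ℝ}

theorem _root_.IsCauchySolution.map_zero (hζ : IsCauchySolution ζ) : ζ 0 = 0 := by
  have := hζ 0 0
  rw [add_zero] at this
  linarith

/-- The contribution of the direction `u` to the facet vector. -/
noncomputable def facetTerm (ζ : ℝ≥0 → ℝ) (P : PolytopeIn n) (u : EuclideanSpace ℝ (Fin n)) :
    EuclideanSpace ℝ (Fin n) :=
  (ζ (P.coneVolume u) / |P.supportFun u|) • u

theorem facetTerm_eq_zero (hζ : IsCauchySolution ζ) (P : PolytopeIn n)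
    {u : EuclideanSpace ℝ (Fin n)} (hu : ‖u‖ = 1)
    (h : u ∉ P.facetNormals \ P.facetNormalsOrigin) : facetTerm ζ P u = 0 := by
  rw [facetTerm, P.coneVolume_eq_zero hu h, hζ.map_zero, zero_div, zero_smul]

theorem facetTerm_support (hζ : IsCauchySolution ζ) (P : PolytopeIn n) :
    Metric.sphere 0 1 ∩ Function.support (facetTerm ζ P) ⊆
      P.facetNormals \ P.facetNormalsOrigin := by
  rintro u ⟨hu, hne⟩
  by_contra h
  exact hne (facetTerm_eq_zero hζ P (by simpa using hu) h)

theorem facetTerm_support_finite (hζ : IsCauchySolution ζ) (P : PolytopeIn n) :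
    (Metric.sphere 0 1 ∩ Function.support (facetTerm ζ P)).Finite :=
  P.facetNormals_finite.subset ((facetTerm_support hζ P).trans Set.sdiff_subset)

theorem facetVector_eq (hζ : IsCauchySolution ζ) (P : PolytopeIn n) :
    facetVector ζ P = ∑ᶠ u ∈ Metric.sphere (0 : EuclideanSpace ℝ (Fin n)) 1, facetTerm ζ P u := by
  refine finsum_mem_inter_support_eq (f := facetTerm ζ P)
    (s := P.facetNormals \ P.facetNormalsOrigin) _ ?_
  apply Set.Subset.antisymm
  · rintro u ⟨hu, hne⟩
    exact ⟨by simpa using hu.1.1, hne⟩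
  · exact Set.subset_inter (facetTerm_support hζ P) Set.inter_subset_right

theorem facetTerm_congr {P Q : PolytopeIn n} {u : EuclideanSpace ℝ (Fin n)}
    (hs : P.supportFun u = Q.supportFun u) (hf : P.face u = Q.face u) :
    facetTerm ζ P u = facetTerm ζ Q u := by
  rw [facetTerm, facetTerm, coneVolume, coneVolume, hs, hf]

/-- The valuation property holds direction by direction. If the support numbers agree, the faces of
`P ∪ Q` and `P ∩ Q` are the union and the intersection of the faces, and the volumes of the cones
add up. Otherwise the faces of `P ∪ Q` and `P ∩ Q` are those of `Q` and `P`. -/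
theorem facetTerm_add_of_le (hζ : IsCauchySolution ζ) {P Q U I : PolytopeIn n}
    (hU : U.carrier = P.carrier ∪ Q.carrier) (hI : I.carrier = P.carrier ∩ Q.carrier)
    (u : EuclideanSpace ℝ (Fin n)) (hle : P.supportFun u ≤ Q.supportFun u) :
    facetTerm ζ P u + facetTerm ζ Q u = facetTerm ζ U u + facetTerm ζ I u := by
  obtain ⟨p, hp, hpu⟩ := P.face_nonempty u
  obtain ⟨q, hq, hqu⟩ := Q.face_nonempty u
  have hUle : ∀ y ∈ U.carrier, inner ℝ y u ≤ Q.supportFun u := by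
    intro y hy
    rw [hU] at hy
    exact hy.elim (fun h => (P.inner_le_supportFun u h).trans hle) (Q.inner_le_supportFun u)
  have hUs : U.supportFun u = Q.supportFun u := by
    rw [← hqu]
    exact U.supportFun_eq_of_forall_le (hU ▸ .inr hq) fun y hy => hqu ▸ hUle y hy
  have hIle : ∀ y ∈ I.carrier, inner ℝ y u ≤ P.supportFun u := fun y hy =>
    P.inner_le_supportFun u (hI ▸ hy : y ∈ P.carrier ∩ Q.carrier).1
  -- Every point of the face of `P` is joined to the face of `Q` through a point of `P ∩ Q`.
  have hcross : ∀ x ∈ P.face u, ∀ y ∈ Q.face u, ∃ r ∈ segment ℝ x y, r ∈ P.carrier ∩ Q.carrier :=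
    fun x hx y hy => exists_mem_segment_inter P.isConvexPolytope.isCompact.isClosed
      Q.isConvexPolytope.isCompact.isClosed hx.1 hy.1
      (hU ▸ U.isConvexPolytope.convex.segment_subset (hU ▸ .inl hx.1) (hU ▸ .inr hy.1))
  rcases hle.eq_or_lt with heq | hlt
  · have hIs : I.supportFun u = P.supportFun u := by
      obtain ⟨r, ⟨a, b, ha, hb, hab, rfl⟩, hr⟩ := hcross p ⟨hp, hpu⟩ q ⟨hq, hqu⟩
      have hru : inner ℝ (a • p + b • q) u = P.supportFun u := by
        rw [inner_add_left, real_inner_smul_left, real_inner_smul_left, hpu, hqu, ← heq, ← add_mul,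
          hab, one_mul]
      rw [← hru]
      exact I.supportFun_eq_of_forall_le (hI ▸ hr) fun y hy => hru ▸ hIle y hy
    have hfU : U.face u = P.face u ∪ Q.face u := by
      ext x
      simp only [face, hU, hUs, heq, Set.mem_ofPred_eq, Set.mem_union]
      tauto
    have hfI : I.face u = P.face u ∩ Q.face u := by
      ext x
      simp only [face, hI, hIs, heq, Set.mem_ofPred_eq, Set.mem_inter_iff]
      tauto
    have hP := P.isConvexPolytope_face u
    have hQ := Q.isConvexPolytope_face u
    have hconv : Convex ℝ (P.face u ∪ Q.face u) := hfU ▸ (U.isConvexPolytope_face u).convex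
    have hvol : P.coneVolume u + Q.coneVolume u = U.coneVolume u + I.coneVolume u := by
      rw [coneVolume, coneVolume, coneVolume, coneVolume,
        ← ENNReal.toNNReal_add (P.volume_cone_lt_top u).ne (Q.volume_cone_lt_top u).ne,
        ← ENNReal.toNNReal_add (U.volume_cone_lt_top u).ne (I.volume_cone_lt_top u).ne, hfU, hfI,
        convexHull_insert_union hP.convex hQ.convex hconv,
        convexHull_insert_inter hP.convex hQ.convex hP.isCompact.isClosed hQ.isCompact.isClosed
          hconv,
        MeasureTheory.measure_union_add_inter _ (hQ.join 0).isCompact.isClosed.measurableSet]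
    rw [facetTerm, facetTerm, facetTerm, facetTerm, hUs, hIs, heq, ← add_smul, ← add_smul,
      ← add_div, ← add_div, ← hζ, ← hζ, hvol]
  · have hfU : U.face u = Q.face u := by
      ext x
      simp only [face, hU, hUs, Set.mem_ofPred_eq, Set.mem_union]
      refine ⟨fun ⟨h, hx⟩ => ⟨h.resolve_left fun h => ?_, hx⟩, fun ⟨h, hx⟩ => ⟨.inr h, hx⟩⟩
      exact absurd (P.inner_le_supportFun u h) (by rw [hx]; exact hlt.not_ge)
    have hsub : ∀ x ∈ P.face u, x ∈ Q.carrier := by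
      intro x hx
      obtain ⟨r, ⟨a, b, ha, hb, hab, rfl⟩, hr⟩ := hcross x hx q ⟨hq, hqu⟩
      have hru := P.inner_le_supportFun u hr.1
      rw [inner_add_left, real_inner_smul_left, real_inner_smul_left, hx.2, hqu] at hru
      obtain rfl : a = 1 - b := by linarith
      obtain rfl : b = 0 := le_antisymm (by nlinarith) hb
      simpa using hr.2
    have hIs : I.supportFun u = P.supportFun u := by
      rw [← hpu]
      exact I.supportFun_eq_of_forall_le (hI ▸ ⟨hp, hsub p ⟨hp, hpu⟩⟩) fun y hy => hpu ▸ hIle y hy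
    have hfI : I.face u = P.face u := by
      ext x
      constructor
      · rintro ⟨hx, hxu⟩
        exact ⟨(hI ▸ hx : x ∈ P.carrier ∩ Q.carrier).1, hxu.trans hIs⟩
      · intro hx
        exact ⟨hI ▸ ⟨hx.1, hsub x hx⟩, hx.2.trans hIs.symm⟩
    rw [facetTerm_congr hUs hfU, facetTerm_congr hIs hfI, add_comm]

theorem isValuation_facetVector (hζ : IsCauchySolution ζ) :
    IsValuation (facetVector ζ : PolytopeIn n → _) := by
  intro P Q U I hU hI
  simp only [facetVector_eq hζ]
  rw [← finsum_mem_add_distrib' (facetTerm_support_finite hζ P) (facetTerm_support_finite hζ Q),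
    ← finsum_mem_add_distrib' (facetTerm_support_finite hζ U) (facetTerm_support_finite hζ I)]
  refine finsum_mem_congr rfl fun u _ => ?_
  rcases le_total (P.supportFun u) (Q.supportFun u) with h | h
  · exact facetTerm_add_of_le hζ hU hI u h
  · rw [add_comm (facetTerm ζ P u)]
    exact facetTerm_add_of_le hζ (by rw [hU, Set.union_comm]) (by rw [hI, Set.inter_comm]) u h

theorem IsValuation.comp_convOrigin {Z : PolytopeIn n → EuclideanSpace ℝ (Fin n)}
    (hZ : IsValuation Z) : IsValuation fun P => Z P.convOrigin := by
  intro P Q U I hU hI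
  have hconv : Convex ℝ (P.carrier ∪ Q.carrier) := hU ▸ U.isConvexPolytope.convex
  refine hZ _ _ _ _ ?_ ?_
  · change convexHull ℝ (insert 0 U.carrier) = _
    rw [hU]
    exact convexHull_insert_union P.isConvexPolytope.convex Q.isConvexPolytope.convex hconv 0
  · change convexHull ℝ (insert 0 I.carrier) = _
    rw [hI]
    exact convexHull_insert_inter P.isConvexPolytope.convex Q.isConvexPolytope.convex
      P.isConvexPolytope.isCompact.isClosed Q.isConvexPolytope.isCompact.isClosed hconv 0

end FacetVector

section Contravariance

variable {n : ℕ} {ζ : ℝ≥0 → ℝ}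

theorem inner_toEuclideanLin_transpose (A : Matrix (Fin n) (Fin n) ℝ)
    (x y : EuclideanSpace ℝ (Fin n)) :
    inner ℝ (Matrix.toEuclideanLin A x) y = inner ℝ x (Matrix.toEuclideanLin A.transpose y) := by
  have := Matrix.toEuclideanLin_conjTranspose_eq_adjoint A
  rw [Matrix.conjTranspose_eq_transpose_of_trivial] at this
  rw [this, LinearMap.adjoint_inner_right]

theorem toEuclideanLin_mul_apply (A B : Matrix (Fin n) (Fin n) ℝ) (x : EuclideanSpace ℝ (Fin n)) :
    Matrix.toEuclideanLin (A * B) x = Matrix.toEuclideanLin A (Matrix.toEuclideanLin B x) := by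
  simp [Matrix.toLpLin_apply, Matrix.mulVec_mulVec]

theorem inner_toEuclideanLin_inv_transpose (φ : Matrix.SpecialLinearGroup (Fin n) ℝ)
    (x y : EuclideanSpace ℝ (Fin n)) :
    inner ℝ (Matrix.toEuclideanLin φ.1 x) (Matrix.toEuclideanLin (φ.1⁻¹).transpose y) =
      inner ℝ x y := by
  have hdet : IsUnit φ.1.det := by rw [φ.2]; exact isUnit_one
  rw [inner_toEuclideanLin_transpose, ← toEuclideanLin_mul_apply, ← Matrix.transpose_mul,
    Matrix.nonsing_inv_mul _ hdet]
  simp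

theorem det_toEuclideanLin (A : Matrix (Fin n) (Fin n) ℝ) :
    LinearMap.det (Matrix.toEuclideanLin A) = A.det := by
  rw [Matrix.toEuclideanLin_eq_toLin_orthonormal, LinearMap.det_toLin]

/-- A linear automorphism acts on directions by a bijection of the unit sphere. -/
theorem bijOn_sphere_normalize {E : Type*} [NormedAddCommGroup E] [NormedSpace ℝ E]
    (B : E ≃ₗ[ℝ] E) :
    Set.BijOn (fun u => ‖B u‖⁻¹ • B u) (Metric.sphere 0 1) (Metric.sphere 0 1) := by
  have hB : ∀ u ∈ Metric.sphere (0 : E) 1, 0 < ‖B u‖ := by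
    intro u hu
    refine norm_pos_iff.2 fun h => ?_
    rw [B.map_eq_zero_iff] at h
    simp [h] at hu
  refine ⟨fun u hu => ?_, fun u hu v hv h => ?_, fun v hv => ?_⟩
  · simp [norm_smul, (hB u hu).ne']
  · have h : ‖B u‖⁻¹ • B u = ‖B v‖⁻¹ • B v := h
    have h1 : ‖B u‖⁻¹ • u = ‖B v‖⁻¹ • v := B.injective (by simpa using h)
    have h2 := congrArg norm h1
    rw [mem_sphere_zero_iff_norm] at hu hv
    rw [norm_smul, norm_smul, hu, hv, mul_one, mul_one, norm_inv, norm_inv, norm_norm, norm_norm,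
      inv_inj] at h2
    rw [h2] at h1
    exact smul_right_injective E
      (inv_ne_zero (hB v (mem_sphere_zero_iff_norm.2 hv)).ne') h1
  · rw [mem_sphere_zero_iff_norm] at hv
    have h0 : B.symm v ≠ 0 := by
      rw [Ne, LinearEquiv.map_eq_zero_iff]
      rintro rfl
      simp at hv
    have h0' := norm_ne_zero_iff.2 h0
    refine ⟨‖B.symm v‖⁻¹ • B.symm v, by simp [norm_smul, h0'], ?_⟩
    simp [norm_smul, hv, smul_smul, h0']

theorem supportFun_image (φ : Matrix.SpecialLinearGroup (Fin n) ℝ) (P : PolytopeIn n)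
    (u : EuclideanSpace ℝ (Fin n)) {c : ℝ} (hc : 0 ≤ c) :
    (P.image φ.1).supportFun (c • Matrix.toEuclideanLin (φ.1⁻¹).transpose u) =
      c * P.supportFun u := by
  obtain ⟨x, hx, hxu⟩ := P.face_nonempty u
  have : ∀ y, inner ℝ (Matrix.toEuclideanLin φ.1 y)
      (c • Matrix.toEuclideanLin (φ.1⁻¹).transpose u) = c * inner ℝ y u := fun y => by
    rw [real_inner_smul_right, inner_toEuclideanLin_inv_transpose]
  rw [supportFun_eq_of_forall_le (P.image φ.1) (x := Matrix.toEuclideanLin φ.1 x) ⟨x, hx, rfl⟩,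
    this, hxu]
  rintro _ ⟨y, hy, rfl⟩
  rw [this, this, hxu]
  exact mul_le_mul_of_nonneg_left (P.inner_le_supportFun u hy) hc

theorem face_image (φ : Matrix.SpecialLinearGroup (Fin n) ℝ) (P : PolytopeIn n)
    (u : EuclideanSpace ℝ (Fin n)) {c : ℝ} (hc : 0 < c) :
    (P.image φ.1).face (c • Matrix.toEuclideanLin (φ.1⁻¹).transpose u) =
      Matrix.toEuclideanLin φ.1 '' P.face u := by
  have : ∀ y, inner ℝ (Matrix.toEuclideanLin φ.1 y)
      (c • Matrix.toEuclideanLin (φ.1⁻¹).transpose u) = c * inner ℝ y u := fun y => by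
    rw [real_inner_smul_right, inner_toEuclideanLin_inv_transpose]
  ext x
  constructor
  · rintro ⟨⟨y, hy, rfl⟩, h⟩
    rw [this, supportFun_image φ P u hc.le] at h
    exact ⟨y, ⟨hy, mul_left_cancel₀ hc.ne' h⟩, rfl⟩
  · rintro ⟨y, ⟨hy, h⟩, rfl⟩
    exact ⟨⟨y, hy, rfl⟩, by rw [this, supportFun_image φ P u hc.le, h]⟩

theorem coneVolume_image (φ : Matrix.SpecialLinearGroup (Fin n) ℝ) (P : PolytopeIn n)
    (u : EuclideanSpace ℝ (Fin n)) {c : ℝ} (hc : 0 < c) :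
    (P.image φ.1).coneVolume (c • Matrix.toEuclideanLin (φ.1⁻¹).transpose u) =
      P.coneVolume u := by
  have hins : insert 0 (Matrix.toEuclideanLin φ.1 '' P.face u) =
      Matrix.toEuclideanLin φ.1 '' insert 0 (P.face u) := by
    rw [Set.image_insert_eq, map_zero]
  rw [coneVolume, face_image φ P u hc, hins, ← LinearMap.image_convexHull,
    MeasureTheory.Measure.addHaar_image_linearMap, det_toEuclideanLin, φ.2]
  simp [coneVolume]

theorem isSLContravariant_facetVector (hζ : IsCauchySolution ζ) :
    IsSLContravariant (facetVector ζ : PolytopeIn n → _) := by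
  intro φ P
  have hdet : IsUnit φ.1.det := by rw [φ.2]; exact isUnit_one
  let B : EuclideanSpace ℝ (Fin n) ≃ₗ[ℝ] EuclideanSpace ℝ (Fin n) :=
    LinearEquiv.ofLinearMap (Matrix.toEuclideanLin (φ.1⁻¹).transpose)
      (Matrix.toEuclideanLin φ.1.transpose)
      (by ext1 x; simp only [LinearMap.comp_apply]
          rw [← toEuclideanLin_mul_apply, ← Matrix.transpose_mul, Matrix.mul_nonsing_inv _ hdet]
          simp)
      (by ext1 x; simp only [LinearMap.comp_apply]
          rw [← toEuclideanLin_mul_apply, ← Matrix.transpose_mul, Matrix.nonsing_inv_mul _ hdet]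
          simp)
  have hB : ∀ u, B u = Matrix.toEuclideanLin (φ.1⁻¹).transpose u := fun u => rfl
  rw [facetVector_eq hζ, facetVector_eq hζ, ← hB]
  have hmap := AddMonoidHom.map_finsum_mem' (s := Metric.sphere 0 1) (f := facetTerm ζ P)
    (B : EuclideanSpace ℝ (Fin n) →ₗ[ℝ] EuclideanSpace ℝ (Fin n)).toAddMonoidHom
    (facetTerm_support_finite hζ P)
  refine Eq.trans ?_ hmap.symm
  symm
  refine finsum_mem_eq_of_bijOn _ (bijOn_sphere_normalize B) fun u hu => ?_
  have hpos : 0 < ‖B u‖⁻¹ := by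
    refine inv_pos.2 (norm_pos_iff.2 fun h => ?_)
    rw [B.map_eq_zero_iff] at h
    simp [h] at hu
  change B (facetTerm ζ P u) = facetTerm ζ (P.image φ.1) (‖B u‖⁻¹ • B u)
  rw [hB] at hpos ⊢
  rw [hB, facetTerm, facetTerm, coneVolume_image φ P u hpos, supportFun_image φ P u hpos.le,
    map_smul, smul_smul, abs_mul, abs_of_pos hpos, div_mul_eq_mul_div, mul_comm (ζ _),
    mul_div_mul_left _ _ hpos.ne']

theorem IsSLContravariant.comp_convOrigin {Z : PolytopeIn n → EuclideanSpace ℝ (Fin n)}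
    (hZ : IsSLContravariant Z) : IsSLContravariant fun P => Z P.convOrigin := by
  intro φ P
  have : (P.image φ.1).convOrigin = P.convOrigin.image φ.1 := by
    apply ext_carrier
    change convexHull ℝ (insert 0 (Matrix.toEuclideanLin φ.1 '' P.carrier)) =
      Matrix.toEuclideanLin φ.1 '' convexHull ℝ (insert 0 P.carrier)
    rw [LinearMap.image_convexHull, Set.image_insert_eq, map_zero]
  simp only [this, hZ φ]

end Contravariance

end PolytopeIn

/-! ### Facet vectors of simplices and the classification -/

namespace PolytopeIn

section SimplexFacetVector

variable {n : ℕ} {ζ : ℝ≥0 → ℝ}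

theorem face_subset_span_of_ne (P : PolytopeIn n) {c : Set (EuclideanSpace ℝ (Fin n))}
    (hc : c ⊆ {0}) {v : Fin n → EuclideanSpace ℝ (Fin n)}
    (hP : P.carrier = convexHull ℝ (c ∪ Set.range v)) {u : EuclideanSpace ℝ (Fin n)} {i : Fin n}
    (hi : inner ℝ (v i) u ≠ P.supportFun u) :
    P.face u ⊆ Submodule.span ℝ (v '' {i}ᶜ) := by
  rintro x ⟨hx, hxu⟩
  rw [hP] at hx
  rw [← innerLeft_apply] at hxu
  have := mem_convexHull_sep_of_eq (innerLeft u) (fun y hy => by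
    rw [innerLeft_apply]
    exact P.inner_le_supportFun u (hP ▸ subset_convexHull ℝ _ hy)) hx hxu
  refine convexHull_min ?_ (Submodule.convex _) this
  rintro y ⟨hy | ⟨j, rfl⟩, hyu⟩
  · rw [show y = 0 from hc hy]; exact Submodule.zero_mem _
  · refine Submodule.subset_span ⟨j, fun hj => hi ?_, rfl⟩
    rw [← innerLeft_apply, ← show j = i from hj]
    exact hyu

/-- Only the directions orthogonal to the facet opposite to the origin contribute to the facet
vector of a full-dimensional simplex. -/
theorem inner_eq_supportFun_of_facetTerm_ne_zero (hζ : IsCauchySolution ζ) (P : PolytopeIn n)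
    {c : Set (EuclideanSpace ℝ (Fin n))} (hc : c ⊆ {0}) {v : Fin n → EuclideanSpace ℝ (Fin n)}
    (hv : LinearIndependent ℝ v) (hP : P.carrier = convexHull ℝ (c ∪ Set.range v))
    {u : EuclideanSpace ℝ (Fin n)} (hu : facetTerm ζ P u ≠ 0) (i : Fin n) :
    inner ℝ (v i) u = P.supportFun u := by
  by_contra hi
  refine hu ?_
  have hsub : convexHull ℝ (insert 0 (P.face u)) ⊆ Submodule.span ℝ (v '' {i}ᶜ) :=
    convexHull_min (Set.insert_subset (Submodule.zero_mem _)
      (P.face_subset_span_of_ne hc hP hi)) (Submodule.convex _)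
  have hne : Submodule.span ℝ (v '' {i}ᶜ) ≠ ⊤ := fun h =>
    (hv.notMem_span_image (s := {i}ᶜ) (x := i) (by simp)) (h ▸ Submodule.mem_top)
  have hvol := MeasureTheory.measure_mono_null hsub
    (MeasureTheory.Measure.addHaar_submodule MeasureTheory.volume _ hne)
  rw [facetTerm, coneVolume, hvol, ENNReal.toNNReal_zero, hζ.map_zero, zero_div, zero_smul]

theorem eq_of_forall_inner_eq {v : Fin n → EuclideanSpace ℝ (Fin n)}
    (hv : LinearIndependent ℝ v) {x y : EuclideanSpace ℝ (Fin n)}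
    (h : ∀ i, inner ℝ (v i) x = inner ℝ (v i) y) : x = y := by
  have hspan : Submodule.span ℝ (Set.range v) = ⊤ :=
    hv.span_eq_top_of_card_eq_finrank' (by simp)
  have hle : Submodule.span ℝ (Set.range v) ≤ (ℝ ∙ (x - y))ᗮ := by
    rw [Submodule.span_le]
    rintro _ ⟨i, rfl⟩
    rw [SetLike.mem_coe, Submodule.mem_orthogonal_singleton_iff_inner_left, inner_sub_right, h,
      sub_self]
  have hmem : x - y ∈ (ℝ ∙ (x - y))ᗮ := hle (hspan ▸ Submodule.mem_top)
  rw [Submodule.mem_orthogonal_singleton_iff_inner_left, inner_self_eq_zero] at hmem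
  exact sub_eq_zero.1 hmem

/-- The normal vector of the facet opposite to the origin, scaled to have inner product `1` with
every vertex of that facet. -/
theorem exists_forall_inner_eq_one {v : Fin n → EuclideanSpace ℝ (Fin n)}
    (hv : LinearIndependent ℝ v) : ∃ w, ∀ i, inner ℝ (v i) w = 1 := by
  obtain ⟨f, hf⟩ := hv.linearIndepOn_id.exists_dual fun _ => 1
  refine ⟨(InnerProductSpace.toDual ℝ _).symm (LinearMap.toContinuousLinearMap f), fun i => ?_⟩
  rw [real_inner_comm, InnerProductSpace.toDual_symm_apply]
  exact hf _ ⟨i, rfl⟩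

theorem eq_smul_of_facetTerm_ne_zero (hζ : IsCauchySolution ζ) (P : PolytopeIn n)
    {c : Set (EuclideanSpace ℝ (Fin n))} (hc : c ⊆ {0}) {v : Fin n → EuclideanSpace ℝ (Fin n)}
    (hv : LinearIndependent ℝ v) (hP : P.carrier = convexHull ℝ (c ∪ Set.range v))
    {w : EuclideanSpace ℝ (Fin n)} (hw : ∀ i, inner ℝ (v i) w = 1)
    {u : EuclideanSpace ℝ (Fin n)} (hu : facetTerm ζ P u ≠ 0) :
    u = P.supportFun u • w :=
  eq_of_forall_inner_eq hv fun i => by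
    rw [inner_eq_supportFun_of_facetTerm_ne_zero hζ P hc hv hP hu i, real_inner_smul_right, hw,
      mul_one]

/-- At the vertices of the facet opposite to the origin, the facet vector of a full-dimensional
simplex has inner product `ζ` of the volume: that facet is the only one to contribute, and the cone
over it is the whole simplex. -/
theorem inner_facetVector_simplex (hn : n ≠ 0) (hζ : IsCauchySolution ζ) (P : PolytopeIn n)
    {v : Fin n → EuclideanSpace ℝ (Fin n)} (hv : LinearIndependent ℝ v)
    (hP : P.carrier = convexHull ℝ (insert 0 (Set.range v))) (i : Fin n) :
    inner ℝ (facetVector ζ P) (v i) = ζ (MeasureTheory.volume P.carrier).toNNReal := by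
  obtain ⟨w, hw⟩ := exists_forall_inner_eq_one hv
  have hw0 : w ≠ 0 := by
    rintro rfl
    have := hw ⟨0, Nat.pos_of_ne_zero hn⟩
    simp at this
  have hwn : 0 < ‖w‖ := norm_pos_iff.2 hw0
  have hle : ∀ y ∈ P.carrier, inner ℝ y (‖w‖⁻¹ • w) ≤ ‖w‖⁻¹ := by
    intro y hy
    rw [hP] at hy
    rw [← innerLeft_apply]
    refine convexHull_min ?_ (convex_halfSpace_le (innerLeft _).isLinear _) hy
    rintro z (rfl | ⟨j, rfl⟩)
    · simp
    · simp only [Set.mem_ofPred_eq]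
      rw [innerLeft_apply, real_inner_smul_right, hw, mul_one]
  have hvmem : ∀ j, v j ∈ P.carrier := fun j => hP ▸ subset_convexHull ℝ _ (.inr ⟨j, rfl⟩)
  have h0mem : (0 : EuclideanSpace ℝ (Fin n)) ∈ P.carrier :=
    hP ▸ subset_convexHull ℝ _ (.inl rfl)
  have hvu : ∀ j, inner ℝ (v j) (‖w‖⁻¹ • w) = ‖w‖⁻¹ := fun j => by
    rw [real_inner_smul_right, hw, mul_one]
  have hs : P.supportFun (‖w‖⁻¹ • w) = ‖w‖⁻¹ := by
    have j : Fin n := ⟨0, Nat.pos_of_ne_zero hn⟩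
    rw [P.supportFun_eq_of_forall_le (hvmem j) fun y hy => by rw [hvu]; exact hle y hy, hvu]
  have hcone : convexHull ℝ (insert 0 (P.face (‖w‖⁻¹ • w))) = P.carrier := by
    apply Set.Subset.antisymm
    · exact convexHull_min (Set.insert_subset h0mem fun x hx => hx.1) P.isConvexPolytope.convex
    · rw [hP]
      refine convexHull_mono (Set.insert_subset_insert ?_)
      rintro _ ⟨j, rfl⟩
      exact ⟨hvmem j, by rw [hvu, hs]⟩
  have hterm : facetTerm ζ P (‖w‖⁻¹ • w) = ζ (MeasureTheory.volume P.carrier).toNNReal • w := by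
    rw [facetTerm, coneVolume, hcone, hs, abs_of_pos (inv_pos.2 hwn), smul_smul, div_mul_cancel₀ _
      (inv_pos.2 hwn).ne']
  have hsupp : Metric.sphere 0 1 ∩ Function.support (facetTerm ζ P) =
      {‖w‖⁻¹ • w} ∩ Function.support (facetTerm ζ P) := by
    ext u
    refine and_congr_left fun hu => ⟨fun hu1 => ?_, fun h => ?_⟩
    · have huw := eq_smul_of_facetTerm_ne_zero hζ P (c := {0}) subset_rfl hv
        (by rw [hP, Set.singleton_union]) hw hu
      have hnn : 0 ≤ P.supportFun u := by simpa using P.inner_le_supportFun u h0mem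
      rw [mem_sphere_zero_iff_norm, huw, norm_smul, Real.norm_of_nonneg hnn] at hu1
      rw [Set.mem_singleton_iff, ← eq_inv_of_mul_eq_one_left hu1]
      exact huw
    · rw [Set.mem_singleton_iff.1 h]
      simp [norm_smul, hwn.ne']
  rw [facetVector_eq hζ, finsum_mem_inter_support_eq _ _ _ hsupp, finsum_mem_singleton, hterm,
    real_inner_smul_left, real_inner_comm, hw, mul_one]

/-- The two unit normals of an `(n - 1)`-dimensional simplex contribute opposite vectors. -/
theorem facetVector_eq_zero_of_flat_simplex (hn : n ≠ 0) (hζ : IsCauchySolution ζ)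
    (P : PolytopeIn n) {v : Fin n → EuclideanSpace ℝ (Fin n)} (hv : LinearIndependent ℝ v)
    (hP : P.carrier = convexHull ℝ (Set.range v)) : facetVector ζ P = 0 := by
  obtain ⟨w, hw⟩ := exists_forall_inner_eq_one hv
  have hw0 : w ≠ 0 := by
    rintro rfl
    have := hw ⟨0, Nat.pos_of_ne_zero hn⟩
    simp at this
  have hwn : 0 < ‖w‖ := norm_pos_iff.2 hw0
  have hconst : ∀ y ∈ P.carrier, inner ℝ y w = 1 := by
    intro y hy
    rw [hP] at hy
    rw [← innerLeft_apply]
    refine convexHull_min ?_ (convex_hyperplane (innerLeft _).isLinear _) hy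
    rintro _ ⟨j, rfl⟩
    simp only [Set.mem_ofPred_eq]
    rw [innerLeft_apply, hw]
  have hs : ∀ r : ℝ, P.supportFun (r • w) = r := fun r => by
    obtain ⟨x, hx⟩ := P.carrier_nonempty
    rw [P.supportFun_eq_of_forall_le hx, real_inner_smul_right, hconst x hx, mul_one]
    intro y hy
    rw [real_inner_smul_right, real_inner_smul_right, hconst x hx, hconst y hy]
  have hf : ∀ r : ℝ, P.face (r • w) = P.carrier := fun r => by
    ext x
    refine ⟨fun h => h.1, fun h => ⟨h, ?_⟩⟩
    rw [hs, real_inner_smul_right, hconst x h, mul_one]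
  have hodd : facetTerm ζ P (-‖w‖⁻¹ • w) = -facetTerm ζ P (‖w‖⁻¹ • w) := by
    rw [facetTerm, facetTerm, coneVolume, coneVolume, hf, hf, hs, hs, abs_neg]
    module
  have hsupp : Metric.sphere 0 1 ∩ Function.support (facetTerm ζ P) =
      {‖w‖⁻¹ • w, -‖w‖⁻¹ • w} ∩ Function.support (facetTerm ζ P) := by
    ext u
    refine and_congr_left fun hu => ⟨fun hu1 => ?_, fun h => ?_⟩
    · have huw := eq_smul_of_facetTerm_ne_zero hζ P (Set.empty_subset _) hv
        (by rw [hP, Set.empty_union]) hw hu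
      rw [mem_sphere_zero_iff_norm, huw, norm_smul, Real.norm_eq_abs] at hu1
      rcases abs_choice (P.supportFun u) with h | h <;> rw [h] at hu1
      · left
        rw [← eq_inv_of_mul_eq_one_left hu1]
        exact huw
      · right
        rw [Set.mem_singleton_iff, ← eq_inv_of_mul_eq_one_left hu1, neg_neg]
        exact huw
    · rcases h with rfl | h
      · simp [norm_smul, hwn.ne']
      · rw [Set.mem_singleton_iff.1 h]
        simp [norm_smul, hwn.ne']
  have hne : ‖w‖⁻¹ • w ≠ -‖w‖⁻¹ • w := by
    intro h
    have := smul_left_injective ℝ hw0 h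
    have := inv_pos.2 hwn
    linarith
  rw [facetVector_eq hζ, finsum_mem_inter_support_eq _ _ _ hsupp, finsum_mem_pair hne, hodd,
    add_neg_cancel]

end SimplexFacetVector

section Volume

variable {n : ℕ}

theorem volume_simplex (b : Module.Basis (Fin n) ℝ (EuclideanSpace ℝ (Fin n)))
    (v : Fin n → EuclideanSpace ℝ (Fin n)) :
    MeasureTheory.volume (convexHull ℝ (insert 0 (Set.range v))) =
      ENNReal.ofReal |b.det v| * MeasureTheory.volume (convexHull ℝ (insert 0 (Set.range b))) := by
  let φ := b.constr ℝ v
  have hφb : φ ∘ b = v := funext fun i => b.constr_basis ℝ v i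
  have hset : φ '' convexHull ℝ (insert 0 (Set.range b)) =
      convexHull ℝ (insert 0 (Set.range v)) := by
    rw [LinearMap.image_convexHull, Set.image_insert_eq, map_zero, ← Set.range_comp, hφb]
  have hdet : b.det v = LinearMap.det φ := by
    have := b.det_comp φ b
    rwa [hφb, b.det_self, mul_one] at this
  rw [← hset, MeasureTheory.Measure.addHaar_image_linearMap, hdet]

theorem volume_simplex_pos (b : Module.Basis (Fin n) ℝ (EuclideanSpace ℝ (Fin n))) :
    0 < MeasureTheory.volume (convexHull ℝ (insert 0 (Set.range b))) := by
  refine MeasureTheory.Measure.measure_pos_of_nonempty_interior _ ?_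
  rw [interior_convexHull_nonempty_iff_affineSpan_eq_top, ← SetLike.coe_set_eq,
    affineSpan_insert_zero, b.span_eq]
  simp

end Volume

section Extension

variable {n : ℕ} {Z : PolytopeIn n → EuclideanSpace ℝ (Fin n)}

open Classical in
/-- A vector-valued function on polytopes as a functional-valued function on all sets, with value
zero on the empty set and on every other set that is not a polytope. -/
noncomputable def toSetFunction (Z : PolytopeIn n → EuclideanSpace ℝ (Fin n))
    (S : Set (EuclideanSpace ℝ (Fin n))) : EuclideanSpace ℝ (Fin n) →ₗ[ℝ] ℝ :=
  if h : ∃ P : PolytopeIn n, P.carrier = S then (innerₛₗ ℝ) (Z h.choose) else 0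

theorem toSetFunction_carrier (Z : PolytopeIn n → EuclideanSpace ℝ (Fin n)) (P : PolytopeIn n)
    (x : EuclideanSpace ℝ (Fin n)) : toSetFunction Z P.carrier x = inner ℝ (Z P) x := by
  have h : ∃ Q : PolytopeIn n, Q.carrier = P.carrier := ⟨P, rfl⟩
  rw [toSetFunction, dif_pos h, ext_carrier h.choose_spec, innerₛₗ_apply_apply]

theorem toSetFunction_empty (Z : PolytopeIn n → EuclideanSpace ℝ (Fin n)) :
    toSetFunction Z ∅ = 0 :=
  dif_neg fun ⟨P, hP⟩ => P.carrier_nonempty.ne_empty hP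

theorem exists_carrier_eq {S : Set (EuclideanSpace ℝ (Fin n))} (hS : IsConvexPolytope S)
    (hne : S.Nonempty) : ∃ P : PolytopeIn n, P.carrier = S := by
  obtain ⟨s, hs, rfl⟩ := hS
  exact ⟨⟨_, s, hs, convexHull_nonempty_iff.1 hne, rfl⟩, rfl⟩

theorem IsValuation.toSetFunction (hZ : IsValuation Z) :
    IsPolytopeValuation (toSetFunction Z) where
  empty := toSetFunction_empty Z
  add S T hS hT hST := by
    rcases S.eq_empty_or_nonempty with rfl | hSne
    · simp [add_comm]
    rcases T.eq_empty_or_nonempty with rfl | hTne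
    · simp
    obtain ⟨p, hp⟩ := hSne
    obtain ⟨q, hq⟩ := hTne
    obtain ⟨r, -, hr⟩ := exists_mem_segment_inter hS.isCompact.isClosed hT.isCompact.isClosed hp hq
      (hST.convex.segment_subset (.inl hp) (.inr hq))
    obtain ⟨U, hU⟩ := exists_carrier_eq hST ⟨p, .inl hp⟩
    obtain ⟨I, hI⟩ := exists_carrier_eq (hS.inter hT) ⟨r, hr⟩
    obtain ⟨P, rfl⟩ := exists_carrier_eq hS ⟨p, hp⟩
    obtain ⟨Q, rfl⟩ := exists_carrier_eq hT ⟨q, hq⟩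
    rw [← hU, ← hI]
    ext1 x
    simp only [LinearMap.add_apply, toSetFunction_carrier, ← inner_add_left, hZ P Q U I hU hI]

theorem IsSLContravariant.toSetFunction (hZ : IsSLContravariant Z) :
    IsUnimodularContravariant (toSetFunction Z) := by
  intro φ hφ S hS x
  rcases S.eq_empty_or_nonempty with rfl | hne
  · simp [toSetFunction_empty]
  obtain ⟨P, rfl⟩ := exists_carrier_eq hS hne
  obtain ⟨A, rfl⟩ := (Matrix.toEuclideanLin (𝕜 := ℝ) (m := Fin n) (n := Fin n)).surjective φ
  rw [det_toEuclideanLin] at hφ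
  have himg : Matrix.toEuclideanLin A '' P.carrier = (P.image A).carrier := rfl
  have hcon := hZ ⟨A, hφ⟩ P
  have hinner := inner_toEuclideanLin_inv_transpose ⟨A, hφ⟩ x (Z P)
  rw [himg, toSetFunction_carrier, toSetFunction_carrier, real_inner_comm, hcon, hinner,
    real_inner_comm]

end Extension

end PolytopeIn

section Classification

theorem isCauchySolution_of_add_pos {η : ℝ → ℝ}
    (hη : ∀ x y, 0 < x → 0 < y → η (x + y) = η x + η y) {c : ℝ≥0} (hc : 0 < c) :
    IsCauchySolution fun x => if x = 0 then 0 else η (x / c) := by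
  intro x y
  rcases eq_or_ne x 0 with rfl | hx
  · simp
  rcases eq_or_ne y 0 with rfl | hy
  · simp
  have hx' : 0 < (x : ℝ) / c :=
    div_pos (by exact_mod_cast pos_iff_ne_zero.2 hx) (by exact_mod_cast hc)
  have hy' : 0 < (y : ℝ) / c :=
    div_pos (by exact_mod_cast pos_iff_ne_zero.2 hy) (by exact_mod_cast hc)
  simp only [hx, hy, if_false, add_eq_zero, false_and, NNReal.coe_add, add_div]
  exact hη _ _ hx' hy'

theorem IsCauchySolution.sub {ζ ξ : ℝ≥0 → ℝ} (hζ : IsCauchySolution ζ) (hξ : IsCauchySolution ξ) :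
    IsCauchySolution fun x => ζ x - ξ x := fun x y => by
  simp only [hζ x y, hξ x y]; ring

theorem exists_family_of_ncard_eq {n : ℕ} {t : Set (EuclideanSpace ℝ (Fin n))}
    (ht : t.Finite) (hli : LinearIndependent ℝ ((↑) : t → EuclideanSpace ℝ (Fin n)))
    (hcard : t.ncard = n) :
    ∃ v : Fin n → EuclideanSpace ℝ (Fin n), LinearIndependent ℝ v ∧ Set.range v = t := by
  have := ht.to_subtype
  let e : t ≃ Fin n := Finite.equivFinOfCardEq hcard
  refine ⟨fun i => (e.symm i : EuclideanSpace ℝ (Fin n)), hli.comp _ e.symm.injective, ?_⟩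
  ext x
  exact ⟨fun ⟨i, hi⟩ => hi ▸ (e.symm i).2, fun hx => ⟨e ⟨x, hx⟩, by simp⟩⟩

namespace PolytopeIn

theorem IsValuation.add {n : ℕ} {Z W : PolytopeIn n → EuclideanSpace ℝ (Fin n)}
    (hZ : IsValuation Z) (hW : IsValuation W) : IsValuation fun P => Z P + W P :=
  fun P Q U I hU hI => by
    rw [add_add_add_comm, hZ P Q U I hU hI, hW P Q U I hU hI, add_add_add_comm]

theorem IsValuation.sub {n : ℕ} {Z W : PolytopeIn n → EuclideanSpace ℝ (Fin n)}
    (hZ : IsValuation Z) (hW : IsValuation W) : IsValuation fun P => Z P - W P :=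
  fun P Q U I hU hI => by
    rw [sub_add_sub_comm, hZ P Q U I hU hI, hW P Q U I hU hI, sub_add_sub_comm]

theorem IsSLContravariant.add {n : ℕ} {Z W : PolytopeIn n → EuclideanSpace ℝ (Fin n)}
    (hZ : IsSLContravariant Z) (hW : IsSLContravariant W) :
    IsSLContravariant fun P => Z P + W P := fun φ P => by
  change Z _ + W _ = Matrix.toEuclideanLin _ (Z P + W P)
  rw [hZ φ P, hW φ P, map_add]

theorem IsSLContravariant.sub {n : ℕ} {Z W : PolytopeIn n → EuclideanSpace ℝ (Fin n)}
    (hZ : IsSLContravariant Z) (hW : IsSLContravariant W) :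
    IsSLContravariant fun P => Z P - W P := fun φ P => by
  change Z _ - W _ = Matrix.toEuclideanLin _ (Z P - W P)
  rw [hZ φ P, hW φ P, map_sub]

/-- A contravariant valuation vanishes if it vanishes at the vertices of the simplices
`conv v` and `conv ({0} ∪ v)`, for `v` a basis. -/
theorem eq_zero_of_basis_simplices {n : ℕ} (hn : 3 ≤ n)
    {Z : PolytopeIn n → EuclideanSpace ℝ (Fin n)} (hval : IsValuation Z)
    (hcon : IsSLContravariant Z)
    (h : ∀ c ⊆ ({0} : Set (EuclideanSpace ℝ (Fin n))), ∀ v : Fin n → EuclideanSpace ℝ (Fin n),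
      LinearIndependent ℝ v → ∀ P : PolytopeIn n, P.carrier = convexHull ℝ (c ∪ Set.range v) →
      ∀ i, inner ℝ (Z P) (v i) = 0) (P : PolytopeIn n) : Z P = 0 := by
  have hsimplex : ∀ c ⊆ ({0} : Set (EuclideanSpace ℝ (Fin n))),
      ∀ t : Set (EuclideanSpace ℝ (Fin n)), t.Finite →
      LinearIndependent ℝ ((↑) : t → EuclideanSpace ℝ (Fin n)) →
      toSetFunction Z (convexHull ℝ (c ∪ t)) = 0 := by
    intro c hc t ht hli
    have hle : t.ncard ≤ n := by
      have := ht.fintype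
      have h := hli.fintype_card_le_finrank
      rwa [finrank_euclideanSpace_fin, Fintype.card_eq_nat_card] at h
    rcases hle.lt_or_eq with hlt | heq
    · exact hcon.toSetFunction.eq_zero_of_ncard_lt (by simpa using hn) hc ht hli
        (by simpa using hlt)
    · obtain ⟨v, hv, rfl⟩ := exists_family_of_ncard_eq ht hli heq
      obtain ⟨Q, hQ⟩ := exists_carrier_eq (isConvexPolytope_convexHull_union hc ht)
        (convexHull_nonempty_iff.2 ⟨v ⟨0, by omega⟩, .inr ⟨_, rfl⟩⟩)
      have hspan : Submodule.span ℝ (Set.range v) = ⊤ :=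
        hv.span_eq_top_of_card_eq_finrank' (by simp)
      refine LinearMap.ext_on_range hspan fun i => ?_
      rw [← hQ, toSetFunction_carrier, LinearMap.zero_apply]
      exact h c hc v hv Q hQ i
  have hP : toSetFunction Z P.carrier = 0 :=
    hval.toSetFunction.eq_zero_of_linearIndependent (fun t ht hli =>
      ⟨by simpa using hsimplex ∅ (Set.empty_subset _) t ht hli,
        by simpa using hsimplex {0} subset_rfl t ht hli⟩) P.isConvexPolytope
  have := LinearMap.congr_fun hP (Z P)
  rwa [toSetFunction_carrier, LinearMap.zero_apply, inner_self_eq_zero] at this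

theorem isValuation_facetVector_sum {n : ℕ} {ζ₁ ζ₂ : ℝ≥0 → ℝ} (h₁ : IsCauchySolution ζ₁)
    (h₂ : IsCauchySolution ζ₂) :
    IsValuation fun P : PolytopeIn n => facetVector ζ₁ P + facetVector ζ₂ P.convOrigin :=
  (isValuation_facetVector h₁).add (isValuation_facetVector h₂).comp_convOrigin

theorem isSLContravariant_facetVector_sum {n : ℕ} {ζ₁ ζ₂ : ℝ≥0 → ℝ} (h₁ : IsCauchySolution ζ₁)
    (h₂ : IsCauchySolution ζ₂) :
    IsSLContravariant fun P : PolytopeIn n => facetVector ζ₁ P + facetVector ζ₂ P.convOrigin :=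
  (isSLContravariant_facetVector h₁).add (isSLContravariant_facetVector h₂).comp_convOrigin

theorem exists_facetVector_sum {m : ℕ} {Z : PolytopeIn (m + 3) → EuclideanSpace ℝ (Fin (m + 3))}
    (hval : IsValuation Z) (hcon : IsSLContravariant Z) :
    ∃ ζ₁ ζ₂ : ℝ≥0 → ℝ, IsCauchySolution ζ₁ ∧ IsCauchySolution ζ₂ ∧
      ∀ P : PolytopeIn (m + 3), Z P = facetVector ζ₁ P + facetVector ζ₂ P.convOrigin := by
  let b := (EuclideanSpace.basisFun (Fin (m + 3)) ℝ).toBasis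
  set T : Set (EuclideanSpace ℝ (Fin (m + 3))) := convexHull ℝ (insert 0 (Set.range b)) with hT
  have hTtop : MeasureTheory.volume T < ⊤ :=
    (((Set.finite_range b).insert 0).isCompact_convexHull ℝ).measure_lt_top
  set κ : ℝ≥0 := (MeasureTheory.volume T).toNNReal with hκ
  have hκ0 : 0 < κ := ENNReal.toNNReal_pos (volume_simplex_pos b).ne' hTtop.ne
  let f := simplexValue b (toSetFunction Z) {0}
  let g := simplexValue b (toSetFunction Z) ∅
  have hf := isCauchySolution_of_add_pos (η := f) (fun x y hx hy =>
    hcon.toSetFunction.simplexValue_add b hval.toSetFunction subset_rfl hx hy) hκ0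
  have hg := isCauchySolution_of_add_pos (η := g) (fun x y hx hy =>
    hcon.toSetFunction.simplexValue_add b hval.toSetFunction (Set.empty_subset _) hx hy) hκ0
  -- On `conv v` only the second facet vector is present, on `conv ({0} ∪ v)` the two add up.
  refine ⟨_, _, hf.sub hg, hg, fun P => sub_eq_zero.1 ?_⟩
  refine eq_zero_of_basis_simplices (by omega)
    (hval.sub (isValuation_facetVector_sum (hf.sub hg) hg))
    (hcon.sub (isSLContravariant_facetVector_sum (hf.sub hg) hg)) (fun c hc v hv P hP i => ?_) P
  have hdet : b.det v ≠ 0 := by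
    have hspan : Submodule.span ℝ (Set.range v) = ⊤ :=
      hv.span_eq_top_of_card_eq_finrank' (by simp)
    exact (Module.Basis.is_basis_iff_det b |>.1 ⟨hv, hspan⟩).ne_zero
  have hn : m + 3 ≠ 0 := by omega
  -- The volume of `conv ({0} ∪ v)` is `κ |det v|`, so that the rescaling by `κ` cancels.
  set V := (MeasureTheory.volume (convexHull ℝ (insert 0 (Set.range v)))).toNNReal with hV
  have hvol : ∀ η : ℝ → ℝ, (if V = 0 then 0 else η (V / κ)) = η |b.det v| := by
    intro η
    rw [hV, volume_simplex b v, ENNReal.toNNReal_mul, ← hT, ← hκ]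
    have hne : (ENNReal.ofReal |b.det v|).toNNReal * κ ≠ 0 := by
      refine mul_ne_zero (ENNReal.toNNReal_pos ?_ ENNReal.ofReal_ne_top).ne' hκ0.ne'
      simpa using hdet
    have hκ' : (κ : ℝ) ≠ 0 := by exact_mod_cast hκ0.ne'
    simp only [hne, if_false, NNReal.coe_mul]
    rw [mul_div_cancel_right₀ _ hκ', ENNReal.coe_toNNReal_eq_toReal,
      ENNReal.toReal_ofReal (abs_nonneg _)]
  have hZv := hcon.toSetFunction.apply_eq_simplexValue b hc hdet i
  rw [← hP, toSetFunction_carrier] at hZv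
  rcases Set.subset_singleton_iff_eq.1 hc with rfl | rfl
  · have hP' : P.carrier = convexHull ℝ (Set.range v) := by rw [hP, Set.empty_union]
    have hO : P.convOrigin.carrier = convexHull ℝ (insert 0 (Set.range v)) := by
      change convexHull ℝ (insert 0 P.carrier) = _
      rw [hP', Set.insert_eq, convexHull_convexHull_union_right, ← Set.insert_eq]
    rw [inner_sub_left, inner_add_left, hZv,
      facetVector_eq_zero_of_flat_simplex hn (hf.sub hg) P hv hP', inner_zero_left, zero_add,
      inner_facetVector_simplex hn hg _ hv hO, hO, ← hV, hvol g, sub_self]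
  · have hP' : P.carrier = convexHull ℝ (insert 0 (Set.range v)) := by rw [hP, Set.singleton_union]
    have hO : P.convOrigin = P := by
      apply ext_carrier
      change convexHull ℝ (insert 0 P.carrier) = _
      rw [Set.insert_eq_of_mem (hP' ▸ subset_convexHull ℝ _ (.inl rfl)),
        P.isConvexPolytope.convex.convexHull_eq]
    rw [inner_sub_left, inner_add_left, hZv, hO, inner_facetVector_simplex hn (hf.sub hg) _ hv hP',
      inner_facetVector_simplex hn hg _ hv hP', hP', ← hV, hvol f,
      hvol g, sub_add_cancel, sub_self]

end PolytopeIn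

end Classification

theorem theorem1p3 (n : ℕ) (hn : 3 ≤ n) (Z : PolytopeIn n → EuclideanSpace ℝ (Fin n)) :
    (PolytopeIn.IsValuation Z ∧ PolytopeIn.IsSLContravariant Z) ↔
      ∃ ζ₁ ζ₂ : ℝ≥0 → ℝ, IsCauchySolution ζ₁ ∧ IsCauchySolution ζ₂ ∧
        ∀ P : PolytopeIn n,
          Z P = PolytopeIn.facetVector ζ₁ P + PolytopeIn.facetVector ζ₂ P.convOrigin := by
  constructor
  · rintro ⟨hval, hcon⟩
    obtain ⟨m, rfl⟩ := Nat.exists_eq_add_of_le' hn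
    exact PolytopeIn.exists_facetVector_sum hval hcon
  · rintro ⟨ζ₁, ζ₂, h₁, h₂, hZ⟩
    obtain rfl := funext hZ
    exact ⟨PolytopeIn.isValuation_facetVector_sum h₁ h₂,
      PolytopeIn.isSLContravariant_facetVector_sum h₁ h₂⟩
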